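/- Let $f$ be a real continuous $2\pi$-periodic function with Fourier coefficients $\hat f_k=\frac1{2\pi}\int_0^{2\pi}f(x)e^{-ikx}\,dx$ such that $\sum_{k\ge1}k|\hat f_k|<\infty$, and let $\omega_1,\omega_2,\varepsilon,p_\theta>0$. Assume the resonant case: $\lambda:=\omega_2/\omega_1=\mu/\nu$ with $\mu,\nu$ coprime positive integers, and $\hat f_k\neq0$ for some nonzero multiple $k$ of $\nu$. Put $\beta(J_1)=\sqrt{J_1/(J_1+p_\theta)}$ for $J_1>0$ and let $$\mathcal K_{(1)}(\psi,J)=\frac{\omega_1}{\nu}(\nu J_1+\mu J_2)-\frac{\varepsilon\omega_1}{2}\sum_{n\in\mathbb Z\setminus\{0\}}\hat f_{-n\nu}\,i^{n\mu}\beta(J_1)^{|n|\mu}e^{in(\mu\psi_1-\nu\psi_2)}$$ be the first-order averaged (Poincaré–von Zeipel) Hamiltonian in the angles $\psi=(\psi_1,\psi_2)$ and actions $J=(J_1,J_2)$, $J_1>0$. The variables $(\psi,J)$ are related to the original angle-action variables $(\varphi,I)$ by the canonical transformation $\psi=\partial S/\partial J$, $I=\partial S/\partial\varphi$ (both evaluated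 at $(\varphi,J)$), with generating function $S(\varphi,J)=\varphi\cdot J+\varepsilon S_1(\varphi,J)$, where $$S_1(\varphi,J)=2\,\Re\sum_{k=1}^\infty ik\hat f_k\,G_k(\varphi_1,J_1)\,e^{ik\varphi_2},\qquad G_k(\varphi_1,J_1)=\lambda\sum_{n\in\mathbb Z\setminus\{0\},\ n\ne-k\lambda}\frac{i^n}{2n(n+k\lambda)}\beta(J_1)^{|n|}e^{in\varphi_1}.$$ A trajectory is a pair $(\varphi(t),I(t))$, $t\ge0$, with $\varphi_2(0)=0$, that corresponds, at every time $t\geq 0$, under this transformation to a solution $(\psi(t),J(t))$, $t\ge0$, of the Hamiltonian equations $\psi'=\partial\mathcal K_{(1)}/\partial J$, $J'=-\partial\mathcal K_{(1)}/\partial\psi$ with $J_1(t)>0$ (so that $\varphi_2(t)=\omega_2t$). Then for almost all initial data $(\varphi_1(0),I_1(0))\in\mathbb R^2$: if $I_1(0)>0$, there is a trajectory with these initial data, for every prescribed value of $I_2(0)$; and every trajectory with these initial data satisfies $$\lim_{t\to+\infty}\bigl(\varphi_1(t)-\omega_1t\bigr)=\phi(\infty)\in\mathbb R,\qquad \lim_{t\to+\infty}\frac{I_1(t)}t=C>0,$$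 $$C=-\frac{\varepsilon\omega_2}{2}\,f_\nu'\!\left(-\Bigl(\phi(\infty)+\frac\pi2\Bigr)\lambda\right),\qquad f_\nu(x)=\langle f(x)\rangle_{\mathbb Z\nu}=\sum_{k\in\mathbb Z\nu}\hat f_k e^{ikx}.$$ -/

import Mathlib

open Filter Topology MeasureTheory

noncomputable section

namespace VonZeipel

/-- The circle of length `2π` on which the flux profile `f` lives. -/
abbrev Circ : Type := AddCircle (2 * Real.pi)

instance instFactTwoPi : Fact (0 < 2 * Real.pi) := ⟨Real.two_pi_pos⟩

/-- The `k`-th Fourier coefficient `(1/2π) ∫ f(x) exp(-ikx) dx` of a real function on the circle. -/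
def coeff (f : C(Circ, ℝ)) (k : ℤ) : ℂ :=
  fourierCoeff (fun x : Circ => ((f x : ℝ) : ℂ)) k

/-- The average `⟨f⟩_L(x) = ∑_{k ∈ L} coeff f k * exp(ikx)` for a set `L` of Fourier indices. -/
def average (f : C(Circ, ℝ)) (L : Set ℤ) (x : ℝ) : ℂ :=
  ∑' k : L, coeff f (k : ℤ) * Complex.exp (Complex.I * ((k : ℤ) : ℂ) * (x : ℂ))

/-- `β(J₁) = √(J₁ / (J₁ + pθ))`. -/
def beta (pθ J₁ : ℝ) : ℝ := √(J₁ / (J₁ + pθ))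

/-- The first-order term of the averaged Hamiltonian,
`-(ω₁/2) ∑_{n ≠ 0} coeff f (-nν) i^{nμ} β(J₁)^{|n|μ} exp(in(μψ₁ - νψ₂))`.
The terms `n` and `-n` are complex conjugate, so that the sum is real. -/
def avgK₁ (f : C(Circ, ℝ)) (ω₁ pθ : ℝ) (μ ν : ℕ) (ψ₁ ψ₂ J₁ : ℝ) : ℝ :=
  -(ω₁ / 2) * (∑' n : ℤ, if n = 0 then (0 : ℂ) else
    coeff f (-(n * (ν : ℤ))) * Complex.I ^ (n * (μ : ℤ)) *
      ((beta pθ J₁ : ℝ) : ℂ) ^ (n.natAbs * μ) *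
      Complex.exp (Complex.I * (n : ℂ) *
        (((μ : ℝ) * ψ₁ - (ν : ℝ) * ψ₂ : ℝ) : ℂ))).re

/-- The first-order averaged Hamiltonian `(ω₁/ν)(νJ₁ + μJ₂) + ε avgK₁`. -/
def avgHamiltonian (f : C(Circ, ℝ)) (ω₁ ε pθ : ℝ) (μ ν : ℕ) (ψ₁ ψ₂ J₁ J₂ : ℝ) : ℝ :=
  ω₁ / (ν : ℝ) * ((ν : ℝ) * J₁ + (μ : ℝ) * J₂) + ε * avgK₁ f ω₁ pθ μ ν ψ₁ ψ₂ J₁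

/-- `G_k(φ₁, J₁) = lam ∑ i^n / (2n(n + k lam)) β(J₁)^{|n|} exp(inφ₁)`, summed over the integers
`n ≠ 0` with `n ≠ -k lam`. -/
def genG (pθ lam : ℝ) (k : ℕ) (φ₁ J₁ : ℝ) : ℂ :=
  (lam : ℂ) * ∑' n : ℤ, if n = 0 ∨ (n : ℝ) = -((k : ℝ) * lam) then (0 : ℂ) else
    Complex.I ^ n / (2 * (n : ℂ) * ((n : ℂ) + (k : ℂ) * (lam : ℂ))) *
      ((beta pθ J₁ : ℝ) : ℂ) ^ n.natAbs * Complex.exp (Complex.I * (n : ℂ) * (φ₁ : ℂ))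

/-- `S₁(φ, J) = 2 Re ∑_{k ≥ 1} (f')_k G_k(φ₁, J₁) exp(ikφ₂)`, where `(f')_k = i k coeff f k` is the
Fourier coefficient of the derivative of `f`. It does not depend on `J₂`.
The term `k = 0` of the sum vanishes. -/
def genS₁ (f : C(Circ, ℝ)) (pθ lam : ℝ) (φ₁ φ₂ J₁ : ℝ) : ℝ :=
  2 * (∑' k : ℕ, (Complex.I * (k : ℂ) * coeff f (k : ℤ)) * genG pθ lam k φ₁ J₁ *
    Complex.exp (Complex.I * (k : ℂ) * (φ₂ : ℂ))).re

/-- The truncated generating function `S(φ, J) = φ₁J₁ + φ₂J₂ + ε S₁(φ, J)`. -/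
def genS (f : C(Circ, ℝ)) (ε pθ lam : ℝ) (φ₁ φ₂ J₁ J₂ : ℝ) : ℝ :=
  φ₁ * J₁ + φ₂ * J₂ + ε * genS₁ f pθ lam φ₁ φ₂ J₁

/-- The canonical transformation generated by `S`, as a relation between the original coordinates
`(φ, I)` and the transformed coordinates `(ψ, J)`: `ψ = ∂S/∂J` and `I = ∂S/∂φ`, both at `(φ, J)`. -/
structure Corresponds (f : C(Circ, ℝ)) (ε pθ lam : ℝ)
    (φ₁ φ₂ I₁ I₂ ψ₁ ψ₂ J₁ J₂ : ℝ) : Prop where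
  psi_one : ψ₁ = deriv (fun y => genS f ε pθ lam φ₁ φ₂ y J₂) J₁
  psi_two : ψ₂ = deriv (fun y => genS f ε pθ lam φ₁ φ₂ J₁ y) J₂
  act_one : I₁ = deriv (fun x => genS f ε pθ lam x φ₂ J₁ J₂) φ₁
  act_two : I₂ = deriv (fun x => genS f ε pθ lam φ₁ x J₁ J₂) φ₂

/-- `(ψ(t), J(t))`, `t ≥ 0`, stays in the region `J₁ > 0` and solves Hamilton's equations
`ψ' = ∂H/∂J`, `J' = -∂H/∂ψ` for the averaged Hamiltonian `H`. -/
structure IsAvgSolution (f : C(Circ, ℝ)) (ω₁ ε pθ : ℝ) (μ ν : ℕ)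
    (ψ₁ ψ₂ J₁ J₂ : ℝ → ℝ) : Prop where
  pos : ∀ t, 0 ≤ t → 0 < J₁ t
  psi_one : ∀ t, 0 ≤ t → HasDerivWithinAt ψ₁
    (deriv (fun y => avgHamiltonian f ω₁ ε pθ μ ν (ψ₁ t) (ψ₂ t) y (J₂ t)) (J₁ t)) (Set.Ici 0) t
  psi_two : ∀ t, 0 ≤ t → HasDerivWithinAt ψ₂
    (deriv (fun y => avgHamiltonian f ω₁ ε pθ μ ν (ψ₁ t) (ψ₂ t) (J₁ t) y) (J₂ t)) (Set.Ici 0) t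
  act_one : ∀ t, 0 ≤ t → HasDerivWithinAt J₁
    (-deriv (fun x => avgHamiltonian f ω₁ ε pθ μ ν x (ψ₂ t) (J₁ t) (J₂ t)) (ψ₁ t)) (Set.Ici 0) t
  act_two : ∀ t, 0 ≤ t → HasDerivWithinAt J₂
    (-deriv (fun x => avgHamiltonian f ω₁ ε pθ μ ν (ψ₁ t) x (J₁ t) (J₂ t)) (ψ₂ t)) (Set.Ici 0) t

/-- `(φ(t), I(t))`, `t ≥ 0`, is a trajectory of the averaged Hamiltonian expressed in the original
angle-action coordinates. The second angle is `ω₂ t`, hence it starts at `0`. -/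
def IsTrajectory (f : C(Circ, ℝ)) (ω₁ ω₂ ε pθ : ℝ) (μ ν : ℕ)
    (φ₁ φ₂ I₁ I₂ : ℝ → ℝ) : Prop :=
  φ₂ 0 = 0 ∧ ∃ ψ₁ ψ₂ J₁ J₂ : ℝ → ℝ, IsAvgSolution f ω₁ ε pθ μ ν ψ₁ ψ₂ J₁ J₂ ∧
    ∀ t, 0 ≤ t → Corresponds f ε pθ (ω₂ / ω₁)
      (φ₁ t) (φ₂ t) (I₁ t) (I₂ t) (ψ₁ t) (ψ₂ t) (J₁ t) (J₂ t)

end VonZeipel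

end

/-! Let P(z) = ∑_{n ≥ 1} f̂_{-nν} zⁿ, D = zP'(z) and z = i^μ β(J₁)^μ e^{iθ}, with the slow angle θ =
μψ₁ - νψ₂. The terms n and -n of the averaged Hamiltonian are conjugate, so its first-order part is
-εω₁ Re P(z). With κ = εμω₁ the equations for θ and J₁ close up: J₁' = -κ Im D and θ' = -κμ(β'/β) Re
D. Hence dP(z)/dt = -iκμ(β'/β)|D|²: Re P is conserved and -Im P never decreases
(`hasDerivWithinAt_powSum_of_slow`).

Call a level of Re P critical if it is taken at a zero of D in the open disk or at a point of the
unit circle where Im D = 0. Critical levels form a null set (`volume_criticalLevels`): D has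
countably many zeros inside, and on the circle one-dimensional Sard applies, because ∑ k|f̂_k| < ∞
makes P differentiable along it. On a noncritical level an orbit confined to a compact part of the
disk would make Im P unbounded, so J₁ is unbounded (`not_bounded`). By compactness |Im D| ≥ δ on the
level near the circle, so J₁' keeps its sign there, and finally J₁' ≥ κδ. Then |θ'| is at most a
multiple of (log β(J₁))', and log β(J₁) → 0, so θ converges and J₁' has a limit, which is also the
limit of J₁/t (`IsSlowSolution.exists_tendsto`). The formula for C follows from f_ν(x) = f̂_0 + 2 Re
P(e^{-iνx}).

The transformation does not disturb the limits: ψ₁ - φ₁ = O(1/J₁) and I₁ - J₁ = o(J₁), uniformly in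
the angles. Here resonance keeps the nonzero denominators n + kλ at least 1/ν in modulus, and the
coefficients of ∂S₁/∂φ₁ tend to 0 by dominated convergence.

For fixed J₁ the initial level is a nonconstant real-analytic function of φ₁(0), so it is critical
only on a null set. Fubini, and the differentiability of (φ₁, J₁) ↦ (φ₁, I₁), carry this to initial
data (`ae_initialLevel_notMem`). Existence for all t ≥ 0 holds because 0 is a critical level: on any
other level J₁ stays away from 0 (`exists_isSlowSolution`). -/

noncomputable section

namespace VonZeipel

/-! ### Power series in the unit disk -/

/-- The sum of the power series with coefficients `c`. -/
def powSum (c : ℕ → ℂ) (z : ℂ) : ℂ := ∑' n, c n * z ^ n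

/-- The coefficients of `z * d/dz` of the power series with coefficients `c`. -/
def eulerCoeff (c : ℕ → ℂ) (n : ℕ) : ℂ := n * c n

theorem summable_norm_mul_pow {c : ℕ → ℂ} {C : ℝ} (hc : ∀ n, ‖c n‖ ≤ C) {r : ℝ} (h0 : 0 ≤ r)
    (h1 : r < 1) : Summable fun n => ‖c n‖ * r ^ n :=
  Summable.of_nonneg_of_le (fun n => by positivity)
    (fun n => mul_le_mul_of_nonneg_right (hc n) (by positivity))
    ((summable_geometric_of_lt_one h0 h1).mul_left C)

theorem differentiableOn_powSum {c : ℕ → ℂ} {C : ℝ} (hc : ∀ n, ‖c n‖ ≤ C) :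
    DifferentiableOn ℂ (powSum c) (Metric.ball 0 1) := by
  intro z hz
  obtain ⟨r, hzr, hr1⟩ := exists_between (mem_ball_zero_iff.1 hz)
  have h := Complex.differentiableOn_tsum_of_summable_norm
    (summable_norm_mul_pow hc ((norm_nonneg z).trans hzr.le) hr1)
    (F := fun n w => c n * w ^ n) (U := Metric.ball 0 r)
    (fun n => by fun_prop) Metric.isOpen_ball
    (fun n w hw => by
      rw [norm_mul, norm_pow]
      gcongr
      exact (mem_ball_zero_iff.1 hw).le)
  exact (h.differentiableAt (Metric.isOpen_ball.mem_nhds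
    (mem_ball_zero_iff.2 hzr))).differentiableWithinAt

theorem hasSum_eulerCoeff {c : ℕ → ℂ} {C : ℝ} (hc : ∀ n, ‖c n‖ ≤ C) {z : ℂ} (hz : ‖z‖ < 1) :
    HasSum (fun n => eulerCoeff c n * z ^ n) (z * deriv (powSum c) z) := by
  obtain ⟨r, hzr, hr1⟩ := exists_between hz
  have h := Complex.hasSum_deriv_of_summable_norm
    (summable_norm_mul_pow hc ((norm_nonneg z).trans hzr.le) hr1)
    (F := fun n w => c n * w ^ n) (U := Metric.ball 0 r)
    (fun n => by fun_prop) Metric.isOpen_ball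
    (fun n w hw => by
      rw [norm_mul, norm_pow]
      gcongr
      exact (mem_ball_zero_iff.1 hw).le) (mem_ball_zero_iff.2 hzr)
  suffices e : (fun n => eulerCoeff c n * z ^ n) = fun n => z * deriv (fun w => c n * w ^ n) z from
    e ▸ h.mul_left z
  funext n
  rw [deriv_const_mul _ (by fun_prop), deriv_pow_field, eulerCoeff]
  rcases n with _ | n
  · simp
  · simp only [Nat.add_sub_cancel, pow_succ]; ring

theorem powSum_eulerCoeff {c : ℕ → ℂ} {C : ℝ} (hc : ∀ n, ‖c n‖ ≤ C) {z : ℂ} (hz : ‖z‖ < 1) :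
    powSum (eulerCoeff c) z = z * deriv (powSum c) z :=
  (hasSum_eulerCoeff hc hz).tsum_eq

/-- The coefficients n cₙ need not be bounded, so `differentiableOn_powSum` does not apply to them
directly; the identity with z P'(z) does the work. -/
theorem differentiableOn_powSum_eulerCoeff {c : ℕ → ℂ} {C : ℝ} (hc : ∀ n, ‖c n‖ ≤ C) :
    DifferentiableOn ℂ (powSum (eulerCoeff c)) (Metric.ball 0 1) :=
  (differentiableOn_id.mul ((differentiableOn_powSum hc).deriv Metric.isOpen_ball)).congr
    fun _ hz => powSum_eulerCoeff hc (mem_ball_zero_iff.1 hz)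

/-- Chain rule for a power series along a curve given by its logarithmic derivative. -/
theorem hasDerivAt_powSum_comp {c : ℕ → ℂ} {C : ℝ} (hc : ∀ n, ‖c n‖ ≤ C) {w : ℝ → ℂ} {x : ℝ}
    {l : ℂ} (hw : HasDerivAt w (w x * l) x) (hx : ‖w x‖ < 1) :
    HasDerivAt (fun y => powSum c (w y)) (powSum (eulerCoeff c) (w x) * l) x := by
  have h := ((differentiableOn_powSum hc).differentiableAt (Metric.isOpen_ball.mem_nhds
    (mem_ball_zero_iff.2 hx))).hasDerivAt.comp x hw
  refine h.congr_deriv ?_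
  rw [powSum_eulerCoeff hc hx]; ring

theorem norm_powSum_le {c : ℕ → ℂ} {C : ℝ} (hc : ∀ n, ‖c n‖ ≤ C) {z : ℂ} (hz : ‖z‖ < 1) :
    ‖powSum c z‖ ≤ C / (1 - ‖z‖) := by
  refine tsum_of_norm_bounded (g := fun n => C * ‖z‖ ^ n) ?_ fun n => ?_
  · rw [div_eq_mul_inv]
    exact (hasSum_geometric_of_lt_one (norm_nonneg _) hz).mul_left C
  · rw [norm_mul, norm_pow]
    exact mul_le_mul_of_nonneg_right (hc n) (by positivity)

/-- Factoring out z gives a bound that vanishes at the origin, which controls the action map as J →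
0. -/
theorem norm_powSum_le' {c : ℕ → ℂ} {C : ℝ} (hc : ∀ n, ‖c n‖ ≤ C) (h0 : c 0 = 0) {z : ℂ}
    (hz : ‖z‖ < 1) : ‖powSum c z‖ ≤ C * ‖z‖ / (1 - ‖z‖) := by
  have hC : 0 ≤ C := (norm_nonneg _).trans (hc 0)
  have h : powSum c z = z * powSum (fun n => c (n + 1)) z := by
    have hs : Summable fun n => c n * z ^ n := by
      refine Summable.of_norm ?_
      simpa using summable_norm_mul_pow hc (norm_nonneg z) hz
    rw [powSum, hs.tsum_eq_zero_add, h0, zero_mul, zero_add, powSum, ← tsum_mul_left]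
    congr 1; ext n; ring
  rw [h, norm_mul]
  calc _ ≤ ‖z‖ * (C / (1 - ‖z‖)) := by
        gcongr; exact norm_powSum_le (fun n => hc (n + 1)) hz
    _ = _ := by ring

/-- Power series whose coefficients are bounded by a null sequence are uniformly
`o(1 / (1 - |z|))` at the unit circle. -/
theorem exists_norm_powSum_le_of_tendsto_zero {B : ℕ → ℝ} (hB : Tendsto B atTop (𝓝 0)) {η : ℝ}
    (hη : 0 < η) : ∃ A, ∀ c : ℕ → ℂ, (∀ n, ‖c n‖ ≤ B n) →
      ∀ z : ℂ, ‖z‖ < 1 → ‖powSum c z‖ ≤ A + η / (1 - ‖z‖) := by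
  obtain ⟨N, hN⟩ := eventually_atTop.1 (hB.eventually (ge_mem_nhds hη))
  -- The first N terms are bounded outright; the tail, where B ≤ η, is dominated by a geometric
  -- series of ratio |z|.
  refine ⟨∑ n ∈ Finset.range N, B n, fun c hc z hz => ?_⟩
  have hbound : ∀ n, ‖c (n + N) * z ^ (n + N)‖ ≤ η * ‖z‖ ^ n := fun n => by
    rw [norm_mul, norm_pow]
    gcongr ?_ * ?_
    · exact (hc _).trans (hN _ (by omega))
    · exact pow_le_pow_of_le_one (norm_nonneg _) hz.le (by omega)
  have hgeo : HasSum (fun n => η * ‖z‖ ^ n) (η / (1 - ‖z‖)) := by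
    rw [div_eq_mul_inv]
    exact (hasSum_geometric_of_lt_one (norm_nonneg _) hz).mul_left η
  have hs : Summable fun n => c (n + N) * z ^ (n + N) :=
    Summable.of_norm_bounded hgeo.summable hbound
  rw [powSum, ← ((summable_nat_add_iff (f := fun n => c n * z ^ n) N).1 hs).sum_add_tsum_nat_add N]
  refine (norm_add_le _ _).trans (add_le_add ?_ (tsum_of_norm_bounded hgeo hbound))
  refine norm_sum_le_of_le _ fun n _ => ?_
  rw [norm_mul, norm_pow]
  exact (mul_le_of_le_one_right (norm_nonneg _) (pow_le_one₀ (norm_nonneg _) hz.le)).trans (hc n)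

theorem continuousOn_powSum_closedBall {c : ℕ → ℂ} (hc : Summable fun n => ‖c n‖) :
    ContinuousOn (powSum c) (Metric.closedBall 0 1) := by
  refine continuousOn_tsum (fun n => by fun_prop) hc fun n z hz => ?_
  rw [norm_mul, norm_pow]
  exact mul_le_of_le_one_right (norm_nonneg _)
    (pow_le_one₀ (norm_nonneg _) (mem_closedBall_zero_iff.1 hz))

theorem norm_powSum_le_tsum {c : ℕ → ℂ} (hc : Summable fun n => ‖c n‖) {z : ℂ} (hz : ‖z‖ ≤ 1) :
    ‖powSum c z‖ ≤ ∑' n, ‖c n‖ := by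
  refine tsum_of_norm_bounded hc.hasSum fun n => ?_
  rw [norm_mul, norm_pow]
  exact mul_le_of_le_one_right (norm_nonneg _) (pow_le_one₀ (norm_nonneg _) hz)

/-! ### Zeros and null sets of analytic functions -/

theorem coeff_eq_zero_of_powSum_eventually_eq_zero {c : ℕ → ℂ}
    (hc : ∀ᶠ z in 𝓝 (0 : ℂ), HasSum (fun n => c n * z ^ n) 0) : c = 0 := by
  have h : HasFPowerSeriesAt (fun _ : ℂ => (0 : ℂ)) (FormalMultilinearSeries.ofScalars ℂ c) 0 := by
    rw [hasFPowerSeriesAt_iff]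
    filter_upwards [hc] with z hz
    simpa [FormalMultilinearSeries.coeff_ofScalars, mul_comm] using hz
  have := h.eq_zero
  rwa [FormalMultilinearSeries.ofScalars_series_eq_zero] at this

/-- By the identity theorem the zeros form a discrete set, and a discrete Lindelöf space is
countable. -/
theorem countable_zeros_of_analyticOnNhd {𝕜 : Type*} [NontriviallyNormedField 𝕜]
    [SecondCountableTopology 𝕜] {g : 𝕜 → 𝕜} {U : Set 𝕜}
    (hg : AnalyticOnNhd 𝕜 g U) (hU : IsConnected U) {x : 𝕜} (hx : x ∈ U) (hgx : g x ≠ 0) :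
    {z | z ∈ U ∧ g z = 0}.Countable := by
  have h := hg.preimage_zero_mem_codiscreteWithin hgx hx hU
  rw [Set.preimage_compl] at h
  have hd := (isDiscrete_of_codiscreteWithin h).to_subtype
  have hc : (g ⁻¹' {0} ∩ U).Countable :=
    Set.countable_coe_iff.1 (countable_of_Lindelof_of_discrete (X := ↑(g ⁻¹' {0} ∩ U)))
  refine hc.mono ?_
  rintro z ⟨h1, h2⟩
  exact ⟨h2, h1⟩

/-- The preimage of a null set under a non-constant real-analytic function is null. -/
theorem volume_preimage_eq_zero_of_analytic {g : ℝ → ℝ} (hg : AnalyticOnNhd ℝ g Set.univ) {x : ℝ}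
    (hx : deriv g x ≠ 0) {N : Set ℝ} (hN : volume N = 0) : volume (g ⁻¹' N) = 0 := by
  have hZ : {z | z ∈ Set.univ ∧ deriv g z = 0}.Countable :=
    countable_zeros_of_analyticOnNhd hg.deriv isConnected_univ trivial hx
  have hS : volume (g ⁻¹' N ∩ {z | deriv g z ≠ 0}) = 0 := by
    -- Where the derivative does not vanish, the function has a local differentiable inverse, and
    -- differentiable images of null sets are null.
    refine measure_null_of_locally_null _ fun y hy => ?_
    have hstrict := (hg y trivial).hasStrictDerivAt
    set e := (hstrict.hasStrictFDerivAt_equiv hy.2).toOpenPartialHomeomorph g with he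
    have hcoe : (e : ℝ → ℝ) = g :=
      (hstrict.hasStrictFDerivAt_equiv hy.2).toOpenPartialHomeomorph_coe
    have hmem : y ∈ e.source :=
      (hstrict.hasStrictFDerivAt_equiv hy.2).mem_toOpenPartialHomeomorph_source
    refine ⟨(g ⁻¹' N ∩ {z | deriv g z ≠ 0}) ∩ e.source,
      inter_mem_nhdsWithin _ (e.open_source.mem_nhds hmem), ?_⟩
    refine measure_mono_null (t := e.symm '' (g '' ((g ⁻¹' N ∩ {z | deriv g z ≠ 0}) ∩ e.source)))
      (fun z hz => ⟨g z, ⟨z, hz, rfl⟩, by rw [← hcoe]; exact e.left_inv hz.2⟩) ?_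
    refine addHaar_image_eq_zero_of_differentiableOn_of_addHaar_eq_zero volume ?_
      (measure_mono_null ?_ hN)
    · rintro _ ⟨z, hz, rfl⟩
      have hs : e.symm (g z) = z := by rw [← hcoe]; exact e.left_inv hz.2
      have ht : g z ∈ e.target := by rw [← hcoe]; exact e.map_source hz.2
      refine (e.hasDerivAt_symm (f' := deriv g z) ht hz.1.2 ?_).differentiableAt.differentiableWithinAt
      rw [hs, hcoe]
      exact (hg z trivial).differentiableAt.hasDerivAt
    · rintro _ ⟨z, hz, rfl⟩
      exact hz.1.1
  refine measure_mono_null (fun z hz => ?_) (measure_union_null hS (hZ.measure_zero volume))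
  by_cases h : deriv g z = 0
  · exact Or.inr ⟨trivial, h⟩
  · exact Or.inl ⟨hz, h⟩

/-! ### Nonconstancy and critical levels of Re P -/

theorem norm_le_norm_eulerCoeff {b : ℕ → ℂ} (b0 : b 0 = 0) (n : ℕ) : ‖b n‖ ≤ ‖eulerCoeff b n‖ := by
  rcases n with _ | n
  · simp [b0]
  · rw [eulerCoeff, norm_mul, Complex.norm_natCast]
    have : (1 : ℝ) ≤ ((n + 1 : ℕ) : ℝ) := by simp
    exact le_mul_of_one_le_left (norm_nonneg _) this

section

variable {b : ℕ → ℂ} (hb : Summable fun n => ‖eulerCoeff b n‖) (b0 : b 0 = 0)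
include hb b0

theorem summable_norm_of_eulerCoeff : Summable fun n => ‖b n‖ :=
  hb.of_nonneg_of_le (fun _ => norm_nonneg _) (norm_le_norm_eulerCoeff b0)

theorem norm_le_tsum_eulerCoeff (n : ℕ) : ‖b n‖ ≤ ∑' m, ‖eulerCoeff b m‖ :=
  (norm_le_norm_eulerCoeff b0 n).trans (hb.le_tsum n fun _ _ => norm_nonneg _)

theorem exists_powSum_eulerCoeff_ne_zero (hne : b ≠ 0) {r : ℝ} (hr : 0 < r) :
    ∃ z, ‖z‖ < r ∧ ‖z‖ < 1 ∧ powSum (eulerCoeff b) z ≠ 0 := by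
  by_contra! h
  apply hne
  have hz : eulerCoeff b = 0 := by
    refine coeff_eq_zero_of_powSum_eventually_eq_zero ?_
    filter_upwards [Metric.ball_mem_nhds 0 hr, Metric.ball_mem_nhds 0 one_pos] with z hz hz1
    have hz := mem_ball_zero_iff.1 hz
    have hz1 := mem_ball_zero_iff.1 hz1
    have hs := hasSum_eulerCoeff (norm_le_tsum_eulerCoeff hb b0) hz1
    rwa [← powSum_eulerCoeff (norm_le_tsum_eulerCoeff hb b0) hz1, h z hz hz1] at hs
  funext n
  rcases n with _ | n
  · exact b0
  · have := congrFun hz (n + 1)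
    simp only [eulerCoeff, Pi.zero_apply, mul_eq_zero, Nat.cast_eq_zero] at this
    simpa using this

/-- If Re P = c on the circle, the maximum principle for exp(-P) at 0, where P = 0, gives c ≤ 0. The
one for exp(P) then gives |exp P| ≤ e^c ≤ 1 = |exp P(0)|, so exp P attains its maximum modulus at
the centre and is constant, which forces D = 0. -/
theorem not_re_powSum_const_on_sphere (hne : b ≠ 0) {r : ℝ} (hr : 0 < r) (hr1 : r < 1) (c : ℝ) :
    ¬ ∀ z : ℂ, ‖z‖ = r → (powSum b z).re = c := by
  intro h
  have hd := differentiableOn_powSum (norm_le_tsum_eulerCoeff hb b0)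
  have hsub : Metric.closedBall (0 : ℂ) r ⊆ Metric.ball 0 1 := Metric.closedBall_subset_ball hr1
  have hcl : closure (Metric.ball (0 : ℂ) r) = Metric.closedBall 0 r := closure_ball _ hr.ne'
  have hfr : frontier (Metric.ball (0 : ℂ) r) = Metric.sphere 0 r := frontier_ball _ hr.ne'
  have h1 : DiffContOnCl ℂ (fun z => Complex.exp (powSum b z)) (Metric.ball 0 r) := by
    refine DifferentiableOn.diffContOnCl ?_
    rw [hcl]
    exact (hd.mono hsub).cexp
  have h2 : DiffContOnCl ℂ (fun z => Complex.exp (-powSum b z)) (Metric.ball 0 r) := by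
    refine DifferentiableOn.diffContOnCl ?_
    rw [hcl]
    exact (hd.mono hsub).neg.cexp
  have hP0 : powSum b 0 = 0 := by
    rw [powSum, tsum_eq_single 0 fun n hn => by simp [hn]]
    simp [b0]
  have hc0 : (0 : ℂ) ∈ closure (Metric.ball (0 : ℂ) r) := by
    rw [hcl]; simpa using hr.le
  have e1 {z} := Complex.norm_le_of_forall_mem_frontier_norm_le (z := z) Metric.isBounded_ball h1
    (C := Real.exp c) (fun z hz => by
      rw [hfr] at hz
      rw [Complex.norm_exp, h z (by simpa using hz)])
  have e2 := Complex.norm_le_of_forall_mem_frontier_norm_le Metric.isBounded_ball h2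
    (C := Real.exp (-c)) (fun z hz => by
      rw [hfr] at hz
      rw [Complex.norm_exp, Complex.neg_re, h z (by simpa using hz)]) hc0
  have hc : c ≤ 0 := by
    simpa [hP0] using e2
  obtain ⟨z, hzr, hz1, hz⟩ := exists_powSum_eulerCoeff_ne_zero hb b0 hne hr
  have hmax : IsMaxOn (norm ∘ fun z => Complex.exp (powSum b z)) (Metric.ball 0 r) 0 := by
    intro w hw
    have := e1 (subset_closure hw)
    simp only [Set.mem_ofPred_eq, Function.comp, hP0, Complex.exp_zero, norm_one]
    exact this.trans (Real.exp_le_one_iff.2 hc)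
  have hconst := Complex.eqOn_of_isPreconnected_of_isMaxOn_norm
    (convex_ball (0 : ℂ) r).isPreconnected Metric.isOpen_ball h1.differentiableOn
    (Metric.mem_ball_self hr) hmax
  have hev : (fun z => Complex.exp (powSum b z)) =ᶠ[𝓝 z]
      Function.const ℂ (Complex.exp (powSum b 0)) :=
    hconst.eventuallyEq_of_mem (Metric.isOpen_ball.mem_nhds (mem_ball_zero_iff.2 hzr))
  have hder := (hd.differentiableAt (Metric.isOpen_ball.mem_nhds
    (mem_ball_zero_iff.2 hz1))).hasDerivAt.cexp.deriv
  rw [hev.deriv_eq, show deriv (Function.const ℂ (Complex.exp (powSum b 0))) z = 0 from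
    deriv_const _ _] at hder
  have h0 := (mul_eq_zero.1 hder.symm).resolve_left (Complex.exp_ne_zero _)
  rw [powSum_eulerCoeff (norm_le_tsum_eulerCoeff hb b0) hz1, h0, mul_zero] at hz
  exact hz rfl

/-- On the unit circle P need not be complex differentiable, but ∑ n|bₙ| < ∞ allows termwise
differentiation along the circle. -/
theorem hasDerivAt_powSum_exp_mul_I (x : ℝ) :
    HasDerivAt (fun y : ℝ => powSum b (Complex.exp (Complex.I * y)))
      (Complex.I * powSum (eulerCoeff b) (Complex.exp (Complex.I * x))) x := by
  have h1 : ∀ (n : ℕ) (y : ℝ), HasDerivAt (fun y : ℝ => b n * Complex.exp (Complex.I * y) ^ n)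
      (Complex.I * (eulerCoeff b n * Complex.exp (Complex.I * y) ^ n)) y := by
    intro n y
    have h : HasDerivAt (fun y : ℝ => Complex.exp (Complex.I * y))
        (Complex.exp (Complex.I * y) * (Complex.I * 1)) y :=
      ((Complex.ofRealCLM.hasDerivAt (x := y)).const_mul Complex.I).cexp
    refine ((h.pow n).const_mul (b n)).congr_deriv ?_
    rcases n with _ | n
    · simp [eulerCoeff]
    · simp only [Nat.add_sub_cancel, pow_succ, eulerCoeff]; ring
  have hn : ∀ y : ℝ, ‖Complex.exp (Complex.I * y)‖ = 1 := fun y => by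
    rw [mul_comm]; exact Complex.norm_exp_ofReal_mul_I y
  have := hasDerivAt_tsum hb h1 (fun n y => by simp [hn]) (y₀ := 0)
    (Summable.of_norm (by simpa [hn] using summable_norm_of_eulerCoeff hb b0)) x
  rwa [tsum_mul_left] at this

/-- The values of `Re P` at the critical points of `P` in the open disk, and at the critical points
of the restriction of `Re P` to the unit circle. -/
def criticalLevels (b : ℕ → ℂ) : Set ℝ :=
  {c | ∃ z : ℂ, (powSum b z).re = c ∧ (‖z‖ < 1 ∧ powSum (eulerCoeff b) z = 0 ∨
    ‖z‖ = 1 ∧ (powSum (eulerCoeff b) z).im = 0)}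

/-- The zeros of D in the open disk are countable. On the circle the critical levels are critical
values of a differentiable function of one real variable, so the elementary case of Sard's theorem
suffices. -/
theorem volume_criticalLevels (hne : b ≠ 0) : volume (criticalLevels b) = 0 := by
  have hC := norm_le_tsum_eulerCoeff hb b0
  obtain ⟨z, -, hz1, hz⟩ := exists_powSum_eulerCoeff_ne_zero hb b0 hne one_pos
  have hcount := countable_zeros_of_analyticOnNhd
    ((differentiableOn_powSum_eulerCoeff hC).analyticOnNhd Metric.isOpen_ball)
    (Metric.isConnected_ball one_pos) (mem_ball_zero_iff.2 hz1) hz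
  have hsard : volume ((fun x : ℝ => (powSum b (Complex.exp (Complex.I * x))).re) ''
      {x : ℝ | (powSum (eulerCoeff b) (Complex.exp (Complex.I * x))).im = 0}) = 0 := by
    refine addHaar_image_eq_zero_of_det_fderivWithin_eq_zero volume (f' := fun _ => 0)
      (fun x hx => ?_) (fun x hx => by simp [ContinuousLinearMap.det])
    have h := (Complex.reCLM.hasFDerivAt.comp_hasDerivAt x (hasDerivAt_powSum_exp_mul_I hb b0 x))
    have h' : HasDerivAt (fun x : ℝ => (powSum b (Complex.exp (Complex.I * x))).re) 0 x := by
      refine h.congr_deriv ?_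
      have hx : (powSum (eulerCoeff b) (Complex.exp (Complex.I * x))).im = 0 := hx
      simp [hx]
    simpa [hasDerivAt_iff_hasFDerivAt] using h'.hasFDerivAt.hasFDerivWithinAt
  refine measure_mono_null ?_ (measure_union_null
    ((hcount.image fun z => (powSum b z).re).measure_zero volume) hsard)
  rintro c ⟨w, hw, ⟨h1, h2⟩ | ⟨h1, h2⟩⟩
  · exact Or.inl ⟨w, ⟨mem_ball_zero_iff.2 h1, h2⟩, hw⟩
  · have he : Complex.exp (Complex.I * (w.arg : ℝ)) = w := by
      have := Complex.norm_mul_exp_arg_mul_I w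
      rwa [h1, Complex.ofReal_one, one_mul, mul_comm] at this
    exact Or.inr ⟨w.arg, by simpa [he] using h2, by simpa [he] using hw⟩

end

/-! ### Fourier coefficients and the weight β -/

theorem coeff_neg (f : C(Circ, ℝ)) (k : ℤ) : coeff f (-k) = (starRingEnd ℂ) (coeff f k) := by
  simp only [coeff, fourierCoeff, ← integral_conj]
  congr 1
  ext x
  simp only [smul_eq_mul, map_mul, Complex.conj_ofReal, fourier_neg, Complex.conj_conj]

theorem norm_coeff_neg (f : C(Circ, ℝ)) (k : ℤ) : ‖coeff f (-k)‖ = ‖coeff f k‖ := by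
  rw [coeff_neg, RCLike.norm_conj]

theorem norm_exp_I_mul_ofReal (x : ℝ) : ‖Complex.exp (Complex.I * x)‖ = 1 := by
  rw [mul_comm]; exact Complex.norm_exp_ofReal_mul_I x

section beta

variable {p J : ℝ}

/-- The logarithmic derivative of `β`. -/
def logDerivBeta (p J : ℝ) : ℝ := p / (2 * J * (J + p))

theorem beta_nonneg (p J : ℝ) : 0 ≤ beta p J := Real.sqrt_nonneg _

theorem beta_pos (hp : 0 < p) (hJ : 0 < J) : 0 < beta p J := Real.sqrt_pos.2 (by positivity)

theorem beta_sq (hp : 0 < p) (hJ : 0 < J) : beta p J ^ 2 = J / (J + p) :=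
  Real.sq_sqrt (by positivity)

theorem beta_lt_one (hp : 0 < p) (hJ : 0 < J) : beta p J < 1 := by
  rw [beta, Real.sqrt_lt' one_pos, div_lt_iff₀ (by positivity)]
  linarith

theorem logDerivBeta_pos (hp : 0 < p) (hJ : 0 < J) : 0 < logDerivBeta p J := by
  unfold logDerivBeta; positivity

/-- `1 / (1 - β)` is at most `2 (J + p) / p`. -/
theorem one_div_one_sub_beta_le (hp : 0 < p) (hJ : 0 < J) :
    1 / (1 - beta p J) ≤ 2 * (J + p) / p := by
  have h1 := beta_lt_one hp hJ
  have h0 := beta_pos hp hJ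
  have h2 : (1 - beta p J) * (1 + beta p J) = p / (J + p) := by
    have := beta_sq hp hJ
    have h3 : (1 - beta p J) * (1 + beta p J) = 1 - beta p J ^ 2 := by ring
    rw [h3, this]; field_simp; ring
  rw [div_le_iff₀ (by linarith)]
  have h4 : (1 - beta p J) * (J + p) * (1 + beta p J) = p := by
    have : (1 - beta p J) * (J + p) * (1 + beta p J) =
      ((1 - beta p J) * (1 + beta p J)) * (J + p) := by ring
    rw [this, h2]; field_simp
  rw [div_mul_eq_mul_div, le_div_iff₀ hp, one_mul]
  have h5 : 0 ≤ (1 - beta p J) * (J + p) := mul_nonneg (by linarith) (by linarith)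
  nlinarith

theorem beta_le_sqrt (hp : 0 < p) (hJ : 0 < J) : beta p J ≤ √(J / p) :=
  Real.sqrt_le_sqrt (div_le_div_of_nonneg_left hJ.le hp (by linarith))

theorem tendsto_beta_atTop (hp : 0 < p) : Tendsto (beta p) atTop (𝓝 1) := by
  have h : Tendsto (fun J : ℝ => √(1 - p / (J + p))) atTop (𝓝 (√(1 - 0))) :=
    (tendsto_const_nhds.sub (tendsto_const_nhds.div_atTop
      (tendsto_atTop_add_const_right _ _ tendsto_id))).sqrt
  rw [sub_zero, Real.sqrt_one] at h
  refine h.congr' ?_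
  filter_upwards [eventually_gt_atTop 0] with J hJ
  rw [beta]; congr 1; field_simp; ring

theorem hasDerivAt_beta (hp : 0 < p) (hJ : 0 < J) :
    HasDerivAt (beta p) (beta p J * logDerivBeta p J) J := by
  have hne : J + p ≠ 0 := by positivity
  have h1 : HasDerivAt (fun y : ℝ => y / (y + p)) ((1 * (J + p) - J * 1) / (J + p) ^ 2) J :=
    (hasDerivAt_id J).div ((hasDerivAt_id J).add_const p) hne
  have h2 := h1.sqrt (by positivity : J / (J + p) ≠ 0)
  refine h2.congr_deriv ?_
  have hb : √(J / (J + p)) = beta p J := rfl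
  have hb0 := beta_pos hp hJ
  rw [hb, logDerivBeta, div_eq_iff (by positivity)]
  have : beta p J * (p / (2 * J * (J + p))) * (2 * beta p J) =
    beta p J ^ 2 * (p / (J * (J + p))) := by field_simp
  rw [this, beta_sq hp hJ]; field_simp; ring

theorem hasDerivAt_ofReal_beta_pow (hp : 0 < p) (hJ : 0 < J) (m : ℕ) :
    HasDerivAt (fun y => ((beta p y : ℝ) : ℂ) ^ m)
      (((beta p J : ℝ) : ℂ) ^ m * ((m * logDerivBeta p J : ℝ) : ℂ)) J := by
  refine ((hasDerivAt_beta hp hJ).ofReal_comp.pow m).congr_deriv ?_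
  rcases m with _ | m
  · simp
  · push_cast
    simp only [pow_succ]; ring

end beta

/-! ### The averaged Hamiltonian as the real part of a power series -/

/-- The point `i^m β^m exp(iθ)` of the unit disk. -/
def diskPoint (m : ℕ) (p θ J : ℝ) : ℂ :=
  Complex.I ^ m * ((beta p J : ℝ) : ℂ) ^ m * Complex.exp (Complex.I * θ)

theorem norm_diskPoint (m : ℕ) (p θ J : ℝ) : ‖diskPoint m p θ J‖ = beta p J ^ m := by
  simp only [diskPoint, norm_mul, norm_pow, Complex.norm_I, one_pow, one_mul,
    norm_exp_I_mul_ofReal, mul_one, Complex.norm_real, Real.norm_eq_abs,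
    abs_of_nonneg (beta_nonneg p J)]

theorem norm_diskPoint_lt_one {m : ℕ} (hm : 0 < m) {p J : ℝ} (hp : 0 < p) (hJ : 0 < J) (θ : ℝ) :
    ‖diskPoint m p θ J‖ < 1 := by
  rw [norm_diskPoint]
  exact pow_lt_one₀ (beta_nonneg p J) (beta_lt_one hp hJ) hm.ne'

theorem hasDerivAt_diskPoint_angle (m : ℕ) (p θ J : ℝ) :
    HasDerivAt (fun x => diskPoint m p x J) (diskPoint m p θ J * Complex.I) θ := by
  have h : HasDerivAt (fun y : ℝ => Complex.exp (Complex.I * y))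
      (Complex.exp (Complex.I * θ) * (Complex.I * 1)) θ :=
    ((Complex.ofRealCLM.hasDerivAt (x := θ)).const_mul Complex.I).cexp
  refine (h.const_mul _).congr_deriv ?_
  rw [diskPoint]; ring

theorem hasDerivAt_diskPoint_action (m : ℕ) {p J : ℝ} (hp : 0 < p) (hJ : 0 < J) (θ : ℝ) :
    HasDerivAt (fun y => diskPoint m p θ y)
      (diskPoint m p θ J * ((m * logDerivBeta p J : ℝ) : ℂ)) J := by
  refine (((hasDerivAt_ofReal_beta_pow hp hJ m).const_mul _).mul_const _).congr_deriv ?_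
  rw [diskPoint]; ring

/-- The real part of a bilateral series is the real part of a power series. -/
theorem re_tsum_int_eq_re_powSum {s : ℤ → ℂ} {C : ℝ} (hs : ∀ n, ‖s n‖ ≤ C) (s0 : s 0 = 0) {ρ : ℝ}
    (hρ0 : 0 ≤ ρ) (hρ1 : ρ < 1) (θ : ℝ) :
    (∑' n : ℤ, s n * (ρ : ℂ) ^ n.natAbs * Complex.exp (Complex.I * (n : ℂ) * θ)).re =
      (powSum (fun n : ℕ => s n + (starRingEnd ℂ) (s (-n))) (ρ * Complex.exp (Complex.I * θ))).re := by
  have hgeo := (summable_geometric_of_lt_one hρ0 hρ1).mul_left C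
  have hexp : ∀ n : ℤ, ‖Complex.exp (Complex.I * (n : ℂ) * θ)‖ = 1 := fun n => by
    have := norm_exp_I_mul_ofReal (n * θ)
    push_cast at this
    rwa [← mul_assoc] at this
  have h1 : Summable fun n : ℕ => s n * (ρ : ℂ) ^ n * Complex.exp (Complex.I * (n : ℂ) * θ) := by
    refine Summable.of_norm_bounded hgeo fun n => ?_
    have := hexp n
    push_cast at this
    rw [norm_mul, norm_mul, this, mul_one, norm_pow, Complex.norm_real, Real.norm_of_nonneg hρ0]
    gcongr; exact hs _
  have h2 : Summable fun n : ℕ =>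
      s (-n) * (ρ : ℂ) ^ n * Complex.exp (Complex.I * (-n : ℂ) * θ) := by
    refine Summable.of_norm_bounded hgeo fun n => ?_
    have := hexp (-n)
    push_cast at this
    rw [norm_mul, norm_mul, this, mul_one, norm_pow, Complex.norm_real, Real.norm_of_nonneg hρ0]
    gcongr; exact hs _
  have h2' : Summable fun n : ℕ => (starRingEnd ℂ)
      (s (-n) * (ρ : ℂ) ^ n * Complex.exp (Complex.I * (-n : ℂ) * θ)) :=
    Complex.conjCLE.summable.2 h2
  -- The index 0 lies in both halves; `s0` makes the double count harmless.
  have hint := HasSum.of_nat_of_neg (f := fun n : ℤ =>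
    s n * (ρ : ℂ) ^ n.natAbs * Complex.exp (Complex.I * (n : ℂ) * θ))
    (by simpa using h1.hasSum) (by simpa using h2.hasSum)
  rw [hint.tsum_eq, powSum]
  have hterm : ∀ n : ℕ, (s n + (starRingEnd ℂ) (s (-n))) * (ρ * Complex.exp (Complex.I * θ)) ^ n =
      s n * (ρ : ℂ) ^ n * Complex.exp (Complex.I * (n : ℂ) * θ) + (starRingEnd ℂ)
      (s (-n) * (ρ : ℂ) ^ n * Complex.exp (Complex.I * (-n : ℂ) * θ)) := by
    intro n
    have e1 : Complex.exp (Complex.I * θ) ^ n = Complex.exp (Complex.I * (n : ℂ) * θ) := by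
      rw [← Complex.exp_nat_mul]; ring_nf
    have e2 : (starRingEnd ℂ) (Complex.exp (Complex.I * (-n : ℂ) * θ)) =
        Complex.exp (Complex.I * (n : ℂ) * θ) := by
      rw [← Complex.exp_conj]; simp
    simp only [map_mul, map_pow, Complex.conj_ofReal, mul_pow, e1, e2]
    ring
  simp only [hterm]
  rw [h1.tsum_add h2', ← Complex.conj_tsum]
  simp [s0]

/-- The coefficients `coeff f (-nν)`, `n ≥ 1`, of the resonant power series. -/
def resCoeff (f : C(Circ, ℝ)) (ν n : ℕ) : ℂ := if n = 0 then 0 else coeff f (-((n : ℤ) * ν))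

theorem resCoeff_zero (f : C(Circ, ℝ)) (ν : ℕ) : resCoeff f ν 0 = 0 := if_pos rfl

theorem summable_eulerCoeff_resCoeff {f : C(Circ, ℝ)} {ν : ℕ} (hν : 0 < ν)
    (hf : Summable fun k : ℕ => (k : ℝ) * ‖coeff f (k : ℤ)‖) :
    Summable fun n => ‖eulerCoeff (resCoeff f ν) n‖ := by
  have hinj : Function.Injective fun n : ℕ => n * ν := fun a c h => Nat.eq_of_mul_eq_mul_right hν h
  refine (hf.comp_injective hinj).of_nonneg_of_le (fun _ => norm_nonneg _) fun n => ?_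
  rcases n with _ | n
  · simp [eulerCoeff]
  · simp only [eulerCoeff, resCoeff, norm_mul, Complex.norm_natCast, Function.comp,
      Nat.add_eq_zero_iff, one_ne_zero, and_false, if_false, norm_coeff_neg]
    have : (((n + 1) * ν : ℕ) : ℤ) = ((n + 1 : ℕ) : ℤ) * ν := by push_cast; ring
    rw [this]
    gcongr
    exact Nat.le_mul_of_pos_right _ hν

theorem resCoeff_ne_zero {f : C(Circ, ℝ)} {ν : ℕ}
    (hres : (Function.support (coeff f) ∩
      ((AddSubgroup.zmultiples (ν : ℤ) : Set ℤ) \ {0})).Nonempty) : resCoeff f ν ≠ 0 := by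
  obtain ⟨k, hk, hkν, hk0⟩ := hres
  obtain ⟨m, rfl⟩ := AddSubgroup.mem_zmultiples_iff.1 hkν
  intro h
  apply hk
  have hm : m ≠ 0 := by rintro rfl; simp at hk0
  have hz := congrFun h m.natAbs
  rw [resCoeff, if_neg (Int.natAbs_ne_zero.2 hm), Pi.zero_apply, ← norm_eq_zero] at hz
  rw [← norm_eq_zero, smul_eq_mul]
  rcases le_total 0 m with h0 | h0
  · rwa [norm_coeff_neg, Int.natAbs_of_nonneg h0] at hz
  · rwa [Int.ofNat_natAbs_of_nonpos h0, neg_mul, neg_neg] at hz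

theorem exists_norm_coeff_le {f : C(Circ, ℝ)} {ν : ℕ} (hν : 0 < ν)
    (hf : Summable fun k : ℕ => (k : ℝ) * ‖coeff f (k : ℤ)‖) :
    ∃ C, ∀ n, ‖resCoeff f ν n‖ ≤ C :=
  ⟨_, norm_le_tsum_eulerCoeff (summable_eulerCoeff_resCoeff hν hf) (resCoeff_zero f ν)⟩

/-- Since f is real, the terms n and -n are conjugate; their sum is twice a real part, which cancels
the factor 1/2. -/
theorem avgK₁_eq {f : C(Circ, ℝ)} {μ ν : ℕ} (hμ : 0 < μ) (hν : 0 < ν)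
    (hf : Summable fun k : ℕ => (k : ℝ) * ‖coeff f (k : ℤ)‖) (ω₁ : ℝ) {p J : ℝ} (hp : 0 < p)
    (hJ : 0 < J) (ψ₁ ψ₂ : ℝ) :
    avgK₁ f ω₁ p μ ν ψ₁ ψ₂ J =
      -ω₁ * (powSum (resCoeff f ν) (diskPoint μ p (μ * ψ₁ - ν * ψ₂) J)).re := by
  obtain ⟨C, hC⟩ := exists_norm_coeff_le hν hf
  set s : ℤ → ℂ := fun n => if n = 0 then 0 else
    coeff f (-(n * (ν : ℤ))) * Complex.I ^ (n * (μ : ℤ)) with hs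
  have hsC : ∀ n, ‖s n‖ ≤ C := by
    intro n
    by_cases hn : n = 0
    · simpa [hs, hn] using (norm_nonneg _).trans (hC 0)
    · simp only [hs, hn, if_false, norm_mul, norm_zpow, Complex.norm_I, one_zpow, mul_one]
      have := hC n.natAbs
      rw [resCoeff, if_neg (Int.natAbs_ne_zero.2 hn)] at this
      rcases le_total 0 n with h0 | h0
      · rwa [Int.natAbs_of_nonneg h0] at this
      · rwa [Int.ofNat_natAbs_of_nonpos h0, neg_mul, norm_coeff_neg] at this
  have hconv : (∑' n : ℤ, if n = 0 then (0 : ℂ) else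
      coeff f (-(n * (ν : ℤ))) * Complex.I ^ (n * (μ : ℤ)) *
      ((beta p J : ℝ) : ℂ) ^ (n.natAbs * μ) * Complex.exp (Complex.I * (n : ℂ) *
        (((μ : ℝ) * ψ₁ - (ν : ℝ) * ψ₂ : ℝ) : ℂ))) =
      ∑' n : ℤ, s n * ((beta p J ^ μ : ℝ) : ℂ) ^ n.natAbs *
        Complex.exp (Complex.I * (n : ℂ) * (((μ : ℝ) * ψ₁ - (ν : ℝ) * ψ₂ : ℝ) : ℂ)) := by
    congr 1; ext n
    by_cases hn : n = 0
    · simp [hs, hn]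
    · simp only [hs, hn, if_false]
      push_cast
      rw [← pow_mul, mul_comm μ]
  rw [avgK₁, hconv, re_tsum_int_eq_re_powSum hsC (by simp [hs]) (by have := beta_nonneg p J; positivity)
    (pow_lt_one₀ (beta_nonneg p J) (beta_lt_one hp hJ) hμ.ne')]
  have hps : powSum (fun n : ℕ => s n + (starRingEnd ℂ) (s (-n)))
      (((beta p J ^ μ : ℝ) : ℂ) * Complex.exp (Complex.I * ((μ * ψ₁ - ν * ψ₂ : ℝ) : ℂ))) =
      2 * powSum (resCoeff f ν) (diskPoint μ p (μ * ψ₁ - ν * ψ₂) J) := by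
    rw [powSum, powSum, ← tsum_mul_left]
    congr 1; ext n
    rcases n with _ | n
    · simp [hs, resCoeff]
    · have hn : ((n + 1 : ℕ) : ℤ) ≠ 0 := by omega
      have e : Complex.I ^ (((n + 1 : ℕ) : ℤ) * (μ : ℤ)) = (Complex.I ^ μ) ^ (n + 1) := by
        rw [← pow_mul, ← zpow_natCast]; push_cast; ring_nf
      have e' : (starRingEnd ℂ) (Complex.I ^ (-(((n + 1 : ℕ) : ℤ) * (μ : ℤ)))) =
          (Complex.I ^ μ) ^ (n + 1) := by
        rw [map_zpow₀, Complex.conj_I, zpow_neg, ← inv_zpow, inv_neg, Complex.inv_I,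
          neg_neg, e]
      simp only [hs, neg_eq_zero, hn, if_false, map_mul, e, e', resCoeff, neg_mul,
        ← coeff_neg, Nat.add_eq_zero_iff, one_ne_zero, and_false, diskPoint, mul_pow, neg_neg]
      push_cast
      ring
  rw [hps, show (2 : ℂ) = ((2 : ℝ) : ℂ) by norm_num, Complex.re_ofReal_mul]
  ring

/-! ### Small denominators and the generating function -/

/-- The Fourier coefficient of `G_k / (lam β^|n|)`, with the resonant ones left out. -/
def kernelCoeff (lam : ℝ) (k : ℕ) (n : ℤ) : ℂ :=
  if n = 0 ∨ (n : ℝ) = -((k : ℝ) * lam) then (0 : ℂ) else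
    Complex.I ^ n / (2 * (n : ℂ) * ((n : ℂ) + (k : ℂ) * (lam : ℂ)))

/-- Nonzero denominators `n + k μ/ν` are at least `1/ν`. -/
theorem one_le_mul_abs_denominator {μ ν : ℕ} (hν : 0 < ν) {k : ℕ} {n : ℤ}
    (h : (n : ℝ) ≠ -((k : ℝ) * ((μ : ℝ) / ν))) :
    1 ≤ (ν : ℝ) * |(n : ℝ) + k * ((μ : ℝ) / ν)| := by
  have hν' : (0 : ℝ) < ν := by exact_mod_cast hν
  have e : (ν : ℝ) * ((n : ℝ) + k * ((μ : ℝ) / ν)) = ((ν * n + k * μ : ℤ) : ℝ) := by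
    push_cast; field_simp
  have hne : (ν * n + k * μ : ℤ) ≠ 0 := by
    intro h0
    rw [h0, Int.cast_zero] at e
    exact h (by linarith [(mul_eq_zero.1 e).resolve_left hν'.ne'])
  have h1 : (1 : ℝ) ≤ |((ν * n + k * μ : ℤ) : ℝ)| := by
    exact_mod_cast Int.one_le_abs hne
  rwa [← e, abs_mul, abs_of_pos hν'] at h1

section

variable {μ ν : ℕ} (hν : 0 < ν) (k : ℕ) (n : ℤ)
include hν

/-- The factor n cancels against the denominator, and what remains of the denominator is at least
2/ν in modulus. -/
theorem norm_natAbs_mul_kernelCoeff_le :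
    ‖(n : ℂ) * kernelCoeff ((μ : ℝ) / ν) k n‖ ≤ ν / 2 := by
  unfold kernelCoeff
  split_ifs with h
  · rw [mul_zero, norm_zero]; positivity
  · rw [not_or] at h
    have h1 := one_le_mul_abs_denominator hν h.2
    have hn : (n : ℂ) ≠ 0 := by exact_mod_cast h.1
    have e : (n : ℂ) * (Complex.I ^ n / (2 * (n : ℂ) *
        ((n : ℂ) + (k : ℂ) * (((μ : ℝ) / ν : ℝ) : ℂ)))) =
        Complex.I ^ n / (2 * (((n : ℝ) + k * ((μ : ℝ) / ν) : ℝ) : ℂ)) := by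
      push_cast; field_simp
    have hpos : 0 < |(n : ℝ) + k * ((μ : ℝ) / ν)| := by
      by_contra! h0
      have : (ν : ℝ) * |(n : ℝ) + k * ((μ : ℝ) / ν)| ≤ 0 :=
        mul_nonpos_of_nonneg_of_nonpos (by positivity) h0
      linarith
    rw [e, norm_div, norm_zpow, Complex.norm_I, one_zpow, norm_mul, Complex.norm_real,
      Real.norm_eq_abs, Complex.norm_ofNat, div_le_div_iff₀ (by positivity) two_pos]
    linarith

theorem norm_kernelCoeff_le : ‖kernelCoeff ((μ : ℝ) / ν) k n‖ ≤ ν / 2 := by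
  by_cases hn : n = 0
  · simp only [kernelCoeff, hn, true_or, if_true, norm_zero]; positivity
  · refine le_trans ?_ (norm_natAbs_mul_kernelCoeff_le (μ := μ) hν k n)
    rw [norm_mul]
    refine le_mul_of_one_le_left (norm_nonneg _) ?_
    rw [Complex.norm_intCast]
    exact_mod_cast Int.one_le_abs hn

/-- With d = n + kλ one has kλ ≤ |d| + |n|, so the product is at most 1/(2|n|) + 1/(2|d|). This pays
for the extra factor k produced by differentiation in φ₂. -/
theorem norm_mul_kernelCoeff_le :
    k * ((μ : ℝ) / ν) * ‖kernelCoeff ((μ : ℝ) / ν) k n‖ ≤ (1 + ν) / 2 := by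
  by_cases h : n = 0 ∨ (n : ℝ) = -((k : ℝ) * ((μ : ℝ) / ν))
  · simp only [kernelCoeff, h, if_true, norm_zero, mul_zero]; positivity
  · have hk : kernelCoeff ((μ : ℝ) / ν) k n = Complex.I ^ n / (2 * ((n : ℝ) : ℂ) *
        (((n : ℝ) + k * ((μ : ℝ) / ν) : ℝ) : ℂ)) := by
      rw [kernelCoeff, if_neg h]; push_cast; rfl
    rw [not_or] at h
    have h1 := one_le_mul_abs_denominator hν h.2
    have hn : (1 : ℝ) ≤ |(n : ℝ)| := by exact_mod_cast Int.one_le_abs h.1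
    set d := (n : ℝ) + k * ((μ : ℝ) / ν) with hd
    have hpos : 0 < |d| := by
      by_contra! h0
      have : (ν : ℝ) * |d| ≤ 0 := mul_nonpos_of_nonneg_of_nonpos (by positivity) h0
      linarith
    have htri : k * ((μ : ℝ) / ν) ≤ |d| + |(n : ℝ)| := by
      have e : k * ((μ : ℝ) / ν) = d - n := by rw [hd]; ring
      rw [e]
      exact (le_abs_self _).trans (abs_sub _ _)
    rw [hk, norm_div, norm_zpow, Complex.norm_I, one_zpow, norm_mul, norm_mul, Complex.norm_real,
      Complex.norm_real, Real.norm_eq_abs, Real.norm_eq_abs, Complex.norm_ofNat, mul_one_div,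
      div_le_div_iff₀ (by positivity) two_pos]
    nlinarith [mul_le_mul_of_nonneg_right hn hpos.le,
      mul_le_mul_of_nonneg_right h1 (abs_nonneg (n : ℝ))]

end

theorem tendsto_mul_kernelCoeff (lam : ℝ) (k : ℕ) {u : ℕ → ℤ}
    (hu : Tendsto (fun n => |(u n : ℝ)|) atTop atTop) :
    Tendsto (fun n => (u n : ℂ) * kernelCoeff lam k (u n)) atTop (𝓝 0) := by
  have h1 : Tendsto (fun n => 1 / (|(u n : ℝ)| - |(k : ℝ) * lam|)) atTop (𝓝 0) :=
    tendsto_const_nhds.div_atTop (tendsto_atTop_add_const_right _ _ hu)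
  refine squeeze_zero_norm' ?_ h1
  filter_upwards [hu.eventually_gt_atTop (|(k : ℝ) * lam|)] with n hn
  have hpos : 0 < |(u n : ℝ)| - |(k : ℝ) * lam| := by linarith
  unfold kernelCoeff
  split_ifs with h
  · simpa using hpos.le
  · rw [not_or] at h
    have hn0 : (u n : ℂ) ≠ 0 := by exact_mod_cast h.1
    have hle : |(u n : ℝ)| - |(k : ℝ) * lam| ≤ |(u n : ℝ) + k * lam| := by
      have := abs_sub_abs_le_abs_sub (u n : ℝ) (-(k * lam))
      rwa [abs_neg, sub_neg_eq_add] at this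
    have e : (u n : ℂ) * (Complex.I ^ (u n) / (2 * (u n : ℂ) *
        ((u n : ℂ) + (k : ℂ) * (lam : ℂ)))) =
        Complex.I ^ (u n) / (2 * (((u n : ℝ) + k * lam : ℝ) : ℂ)) := by
      push_cast; field_simp
    rw [e, norm_div, norm_zpow, Complex.norm_I, one_zpow, norm_mul, Complex.norm_real,
      Real.norm_eq_abs, Complex.norm_ofNat]
    refine one_div_le_one_div_of_le hpos ?_
    linarith

section genS₁

variable {f : C(Circ, ℝ)} {μ ν : ℕ} (hν : 0 < ν)
  (hf : Summable fun k : ℕ => (k : ℝ) * ‖coeff f (k : ℤ)‖)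
include hν hf

omit hν hf in
theorem genG_eq (p lam : ℝ) (k : ℕ) (φ₁ J : ℝ) :
    genG p lam k φ₁ J = ∑' n : ℤ, lam * kernelCoeff lam k n * ((beta p J : ℝ) : ℂ) ^ n.natAbs *
      Complex.exp (Complex.I * (n : ℂ) * (φ₁ : ℂ)) := by
  rw [genG, ← tsum_mul_left]
  congr 1; ext n
  unfold kernelCoeff
  split_ifs <;> ring

/-- The term `(k, n)` of the coefficients of `S₁` as a Fourier series in `φ₁`. -/
def genTerm (f : C(Circ, ℝ)) (lam φ₂ : ℝ) (k : ℕ) (n : ℤ) : ℂ :=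
  (Complex.I * (k : ℂ) * coeff f (k : ℤ)) * (lam * kernelCoeff lam k n) *
    Complex.exp (Complex.I * (k : ℂ) * (φ₂ : ℂ))

omit hν hf in
theorem norm_exp_I_mul_natCast_mul (k : ℕ) (x : ℝ) :
    ‖Complex.exp (Complex.I * (k : ℂ) * (x : ℂ))‖ = 1 := by
  have := norm_exp_I_mul_ofReal (k * x)
  push_cast at this
  rwa [← mul_assoc] at this

omit hν hf in
theorem norm_exp_I_mul_intCast_mul (k : ℤ) (x : ℝ) :
    ‖Complex.exp (Complex.I * (k : ℂ) * (x : ℂ))‖ = 1 := by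
  have := norm_exp_I_mul_ofReal (k * x)
  push_cast at this
  rwa [← mul_assoc] at this

omit hf in
theorem norm_genTerm_le (φ₂ : ℝ) (k : ℕ) (n : ℤ) :
    ‖genTerm f ((μ : ℝ) / ν) φ₂ k n‖ ≤ (k : ℝ) * ‖coeff f (k : ℤ)‖ * (μ / 2) := by
  have hν' : (0 : ℝ) < ν := by exact_mod_cast hν
  rw [genTerm, norm_mul, norm_exp_I_mul_natCast_mul, mul_one, norm_mul, norm_mul, norm_mul, norm_mul,
    Complex.norm_I, one_mul, Complex.norm_natCast, Complex.norm_real, Real.norm_of_nonneg (by positivity)]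
  gcongr
  calc (μ : ℝ) / ν * ‖kernelCoeff ((μ : ℝ) / ν) k n‖ ≤ μ / ν * (ν / 2) := by
        gcongr; exact norm_kernelCoeff_le hν k n
    _ = μ / 2 := by field_simp

omit hf in
theorem norm_mul_genTerm_le (φ₂ : ℝ) (k : ℕ) (n : ℤ) :
    ‖n * genTerm f ((μ : ℝ) / ν) φ₂ k n‖ ≤ (k : ℝ) * ‖coeff f (k : ℤ)‖ * (μ / 2) := by
  have hν' : (0 : ℝ) < ν := by exact_mod_cast hν
  have e : n * genTerm f ((μ : ℝ) / ν) φ₂ k n = (Complex.I * (k : ℂ) * coeff f (k : ℤ)) *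
      (((μ : ℝ) / ν : ℝ) * (n * kernelCoeff ((μ : ℝ) / ν) k n)) *
      Complex.exp (Complex.I * (k : ℂ) * (φ₂ : ℂ)) := by
    rw [genTerm]; ring
  rw [e, norm_mul, norm_exp_I_mul_natCast_mul, mul_one, norm_mul, norm_mul, norm_mul, norm_mul,
    Complex.norm_I, one_mul, Complex.norm_natCast, Complex.norm_real, Real.norm_of_nonneg (by positivity)]
  gcongr
  calc (μ : ℝ) / ν * ‖n * kernelCoeff ((μ : ℝ) / ν) k n‖ ≤ μ / ν * (ν / 2) := by
        gcongr; exact norm_natAbs_mul_kernelCoeff_le hν k n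
    _ = μ / 2 := by field_simp

/-- The coefficients of the power series in `β exp(iφ₁)` whose real part is `S₁`. -/
def genCoeff (f : C(Circ, ℝ)) (lam φ₂ : ℝ) (n : ℕ) : ℂ :=
  2 * ((∑' k : ℕ, genTerm f lam φ₂ k n) + (starRingEnd ℂ) (∑' k : ℕ, genTerm f lam φ₂ k (-n)))

theorem norm_tsum_genTerm_le (φ₂ : ℝ) (n : ℤ) :
    ‖∑' k : ℕ, genTerm f ((μ : ℝ) / ν) φ₂ k n‖ ≤
      ∑' k : ℕ, (k : ℝ) * ‖coeff f (k : ℤ)‖ * (μ / 2) :=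
  tsum_of_norm_bounded (hf.mul_right _).hasSum fun k => norm_genTerm_le hν φ₂ k n

theorem exists_norm_genCoeff_le :
    ∃ C, ∀ φ₂ n, ‖genCoeff f ((μ : ℝ) / ν) φ₂ n‖ ≤ C := by
  refine ⟨2 * (2 * ∑' k : ℕ, (k : ℝ) * ‖coeff f (k : ℤ)‖ * (μ / 2)), fun φ₂ n => ?_⟩
  rw [genCoeff, norm_mul, Complex.norm_ofNat]
  gcongr
  refine (norm_add_le _ _).trans ?_
  rw [RCLike.norm_conj, two_mul]
  exact add_le_add (norm_tsum_genTerm_le hν hf φ₂ _) (norm_tsum_genTerm_le hν hf φ₂ _)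

/-- A bound for the coefficients `n s_n` of `∂S₁/∂φ₁` that does not depend on `φ₂`. -/
theorem exists_tendsto_norm_mul_tsum_genTerm_le {u : ℕ → ℤ}
    (hu : Tendsto (fun n => |(u n : ℝ)|) atTop atTop) :
    ∃ B : ℕ → ℝ, Tendsto B atTop (𝓝 0) ∧
      ∀ φ₂ n, ‖(u n : ℂ) * ∑' k : ℕ, genTerm f ((μ : ℝ) / ν) φ₂ k (u n)‖ ≤ B n := by
  -- The angle φ₂ enters each term only through a phase of modulus 1, so the absolute sum at φ₂ = 0
  -- serves for all φ₂.
  refine ⟨fun n => ∑' k, ‖(u n : ℂ) * genTerm f ((μ : ℝ) / ν) 0 k (u n)‖, ?_, fun φ₂ n => ?_⟩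
  · have h := tendsto_tsum_of_dominated_convergence (𝓕 := atTop)
      (f := fun n k => ‖(u n : ℂ) * genTerm f ((μ : ℝ) / ν) 0 k (u n)‖) (g := fun _ => (0 : ℝ))
      (hf.mul_right ((μ : ℝ) / 2)) (fun k => by
        have := (((tendsto_mul_kernelCoeff ((μ : ℝ) / ν) k hu).const_mul
          ((Complex.I * (k : ℂ) * coeff f (k : ℤ)) * (((μ : ℝ) / ν : ℝ) : ℂ))).mul_const
          (Complex.exp (Complex.I * (k : ℂ) * ((0 : ℝ) : ℂ)))).norm
        rw [mul_zero, zero_mul, norm_zero] at this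
        refine this.congr fun n => ?_
        rw [genTerm]; ring_nf)
      (Eventually.of_forall fun n k => by
        rw [norm_norm]; exact norm_mul_genTerm_le hν 0 k (u n))
    simpa only [tsum_zero] using h
  · have hs : Summable fun k => ‖(u n : ℂ) * genTerm f ((μ : ℝ) / ν) 0 k (u n)‖ :=
      (hf.mul_right ((μ : ℝ) / 2)).of_nonneg_of_le (fun _ => norm_nonneg _)
        fun k => norm_mul_genTerm_le hν 0 k (u n)
    rw [← tsum_mul_left]
    refine tsum_of_norm_bounded hs.hasSum fun k => le_of_eq ?_
    simp only [genTerm, norm_mul, norm_exp_I_mul_natCast_mul]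

/-- A bound by a null sequence, not merely a constant, is what makes ∂S₁/∂φ₁ of order o(J) rather
than O(J). -/
theorem exists_tendsto_norm_eulerCoeff_genCoeff_le :
    ∃ B : ℕ → ℝ, Tendsto B atTop (𝓝 0) ∧
      ∀ φ₂ n, ‖eulerCoeff (genCoeff f ((μ : ℝ) / ν) φ₂) n‖ ≤ B n := by
  obtain ⟨B₁, h1, hB₁⟩ := exists_tendsto_norm_mul_tsum_genTerm_le (μ := μ) hν hf
    (u := fun n => (n : ℤ)) (by simpa using tendsto_natCast_atTop_atTop)
  obtain ⟨B₂, h2, hB₂⟩ := exists_tendsto_norm_mul_tsum_genTerm_le (μ := μ) hν hf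
    (u := fun n => -(n : ℤ)) (by simpa using tendsto_natCast_atTop_atTop)
  refine ⟨fun n => 2 * (B₁ n + B₂ n), by simpa using (h1.add h2).const_mul 2, fun φ₂ n => ?_⟩
  have e1 := hB₁ φ₂ n
  have e2 := hB₂ φ₂ n
  rw [norm_mul] at e1 e2
  simp only [Int.cast_neg, norm_neg, Int.cast_natCast] at e1 e2
  rw [eulerCoeff, genCoeff, norm_mul, norm_mul, Complex.norm_ofNat, ← mul_assoc,
    mul_comm ‖(n : ℂ)‖, mul_assoc]
  refine mul_le_mul_of_nonneg_left ?_ two_pos.le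
  calc _ ≤ ‖(n : ℂ)‖ * (_ + _) := by gcongr; exact norm_add_le _ _
    _ ≤ _ := by rw [RCLike.norm_conj, mul_add]; exact add_le_add e1 e2

/-- The double series converges absolutely because ∑ k|f̂_k| < ∞ and β < 1, so the sums over k and n
may be exchanged; under the real part, n and -n then combine. -/
theorem genS₁_eq {p J : ℝ} (hp : 0 < p) (hJ : 0 < J) (φ₁ φ₂ : ℝ) :
    genS₁ f p ((μ : ℝ) / ν) φ₁ φ₂ J =
      (powSum (genCoeff f ((μ : ℝ) / ν) φ₂) (beta p J * Complex.exp (Complex.I * φ₁))).re := by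
  have hb0 := beta_nonneg p J
  have hb1 := beta_lt_one hp hJ
  have hswap : (∑' k : ℕ, (Complex.I * (k : ℂ) * coeff f (k : ℤ)) * genG p ((μ : ℝ) / ν) k φ₁ J *
      Complex.exp (Complex.I * (k : ℂ) * (φ₂ : ℂ))) =
      ∑' n : ℤ, (∑' k : ℕ, genTerm f ((μ : ℝ) / ν) φ₂ k n) * ((beta p J : ℝ) : ℂ) ^ n.natAbs *
        Complex.exp (Complex.I * (n : ℂ) * φ₁) := by
    have hgeo : Summable fun n : ℤ => beta p J ^ n.natAbs := by
      refine Summable.of_nat_of_neg ?_ ?_ <;> simpa using summable_geometric_of_lt_one hb0 hb1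
    have hs : Summable (Function.uncurry fun (k : ℕ) (n : ℤ) =>
        genTerm f ((μ : ℝ) / ν) φ₂ k n * ((beta p J : ℝ) : ℂ) ^ n.natAbs *
        Complex.exp (Complex.I * (n : ℂ) * φ₁)) := by
      refine Summable.of_norm_bounded ((hf.mul_right ((μ : ℝ) / 2)).mul_of_nonneg hgeo
        (fun k => by positivity) fun n => by positivity) fun x => ?_
      rw [Function.uncurry, norm_mul, norm_mul, norm_exp_I_mul_intCast_mul, mul_one, norm_pow,
        Complex.norm_real, Real.norm_of_nonneg hb0]
      gcongr
      exact norm_genTerm_le hν φ₂ _ _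
    simp only [← tsum_mul_right]
    rw [hs.tsum_comm]
    congr 1; ext k
    rw [genG_eq, ← tsum_mul_left, ← tsum_mul_right]
    congr 1; ext n
    rw [genTerm]; ring
  rw [genS₁, hswap, re_tsum_int_eq_re_powSum (norm_tsum_genTerm_le hν hf φ₂)
    (by simp [genTerm, kernelCoeff]) hb0 hb1]
  have : powSum (genCoeff f ((μ : ℝ) / ν) φ₂) (beta p J * Complex.exp (Complex.I * φ₁)) =
      2 * powSum (fun n : ℕ => (∑' k : ℕ, genTerm f ((μ : ℝ) / ν) φ₂ k n) +
        (starRingEnd ℂ) (∑' k : ℕ, genTerm f ((μ : ℝ) / ν) φ₂ k (-n)))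
        (beta p J * Complex.exp (Complex.I * φ₁)) := by
    rw [powSum, powSum, ← tsum_mul_left]
    congr 1; ext n
    rw [genCoeff]; ring
  rw [this, show (2 : ℂ) = ((2 : ℝ) : ℂ) by norm_num, Complex.re_ofReal_mul]

/-- Needed for the relation defining I₂. Differentiation in φ₂ brings a second factor k, which is
absorbed by the uniform bound on k |G_k|. -/
theorem differentiableAt_genS₁_snd {p J : ℝ} (hp : 0 < p) (hJ : 0 < J) (φ₁ φ₂ : ℝ) :
    DifferentiableAt ℝ (fun x => genS₁ f p ((μ : ℝ) / ν) φ₁ x J) φ₂ := by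
  have hb0 := beta_nonneg p J
  have hb1 := beta_lt_one hp hJ
  have hgeo : Summable fun n : ℤ => beta p J ^ n.natAbs := by
    refine Summable.of_nat_of_neg ?_ ?_ <;> simpa using summable_geometric_of_lt_one hb0 hb1
  have hG : ∀ k : ℕ, k * ‖genG p ((μ : ℝ) / ν) k φ₁ J‖ ≤
      ∑' n : ℤ, (1 + (ν : ℝ)) / 2 * beta p J ^ n.natAbs := by
    intro k
    have h : ‖(k : ℂ) * genG p ((μ : ℝ) / ν) k φ₁ J‖ ≤
        ∑' n : ℤ, (1 + (ν : ℝ)) / 2 * beta p J ^ n.natAbs := by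
      rw [genG_eq, ← tsum_mul_left]
      refine tsum_of_norm_bounded (hgeo.mul_left _).hasSum fun n => ?_
      rw [norm_mul, norm_mul, norm_mul, norm_mul, norm_exp_I_mul_intCast_mul, mul_one, norm_pow,
        Complex.norm_real, Complex.norm_real, Real.norm_of_nonneg hb0, Complex.norm_natCast,
        Real.norm_of_nonneg (by positivity), ← mul_assoc]
      gcongr
      rw [← mul_assoc]
      exact norm_mul_kernelCoeff_le hν k n
    rwa [norm_mul, Complex.norm_natCast] at h
  have hterm : ∀ (k : ℕ) (x : ℝ), HasDerivAt (fun x : ℝ =>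
      (Complex.I * (k : ℂ) * coeff f (k : ℤ)) * genG p ((μ : ℝ) / ν) k φ₁ J *
      Complex.exp (Complex.I * (k : ℂ) * (x : ℂ)))
      ((Complex.I * (k : ℂ) * coeff f (k : ℤ)) * genG p ((μ : ℝ) / ν) k φ₁ J *
      (Complex.exp (Complex.I * (k : ℂ) * (x : ℂ)) * (Complex.I * k * 1))) x := fun k x =>
    (((Complex.ofRealCLM.hasDerivAt (x := x)).const_mul (Complex.I * (k : ℂ))).cexp).const_mul _
  have hbound : ∀ (k : ℕ) (x : ℝ), ‖(Complex.I * (k : ℂ) * coeff f (k : ℤ)) *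
      genG p ((μ : ℝ) / ν) k φ₁ J *
      (Complex.exp (Complex.I * (k : ℂ) * (x : ℂ)) * (Complex.I * k * 1))‖ ≤
      (k : ℝ) * ‖coeff f (k : ℤ)‖ * ∑' n : ℤ, (1 + (ν : ℝ)) / 2 * beta p J ^ n.natAbs := by
    intro k x
    have e : (Complex.I * (k : ℂ) * coeff f (k : ℤ)) * genG p ((μ : ℝ) / ν) k φ₁ J *
      (Complex.exp (Complex.I * (k : ℂ) * (x : ℂ)) * (Complex.I * k * 1)) =
      (Complex.I * k * coeff f (k : ℤ)) * (k * genG p ((μ : ℝ) / ν) k φ₁ J) *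
      (Complex.exp (Complex.I * (k : ℂ) * (x : ℂ)) * Complex.I) := by ring
    rw [e]
    simp only [norm_mul, norm_exp_I_mul_natCast_mul, Complex.norm_I, mul_one, one_mul,
      Complex.norm_natCast]
    gcongr
    exact hG k
  have hsum : Summable fun k : ℕ => (Complex.I * (k : ℂ) * coeff f (k : ℤ)) *
      genG p ((μ : ℝ) / ν) k φ₁ J * Complex.exp (Complex.I * (k : ℂ) * ((0 : ℝ) : ℂ)) := by
    refine Summable.of_norm_bounded (hf.mul_right
      (∑' n : ℤ, (1 + (ν : ℝ)) / 2 * beta p J ^ n.natAbs)) fun k => ?_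
    rcases k with _ | k
    · simp
    · simp only [norm_mul, norm_exp_I_mul_natCast_mul, Complex.norm_I, mul_one, one_mul,
        Complex.norm_natCast]
      gcongr
      refine le_trans (le_mul_of_one_le_left (norm_nonneg _) ?_) (hG (k + 1))
      simp
  have h := hasDerivAt_tsum (hf.mul_right _) hterm hbound hsum φ₂
  exact ((Complex.reCLM.hasFDerivAt.comp_hasDerivAt φ₂ h).const_mul 2).differentiableAt

end genS₁

/-! ### The canonical transformation and its size -/

/-- The point `β exp(iφ)` of the unit disk. -/
def polarPoint (p φ J : ℝ) : ℂ := ((beta p J : ℝ) : ℂ) * Complex.exp (Complex.I * φ)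

theorem norm_polarPoint (p φ J : ℝ) : ‖polarPoint p φ J‖ = beta p J := by
  rw [polarPoint, norm_mul, norm_exp_I_mul_ofReal, mul_one, Complex.norm_real,
    Real.norm_of_nonneg (beta_nonneg p J)]

theorem norm_polarPoint_lt_one {p J : ℝ} (hp : 0 < p) (hJ : 0 < J) (φ : ℝ) :
    ‖polarPoint p φ J‖ < 1 := by
  rw [norm_polarPoint]; exact beta_lt_one hp hJ

theorem hasDerivAt_polarPoint_angle (p φ J : ℝ) :
    HasDerivAt (fun x => polarPoint p x J) (polarPoint p φ J * Complex.I) φ := by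
  have h : HasDerivAt (fun y : ℝ => Complex.exp (Complex.I * y))
      (Complex.exp (Complex.I * φ) * (Complex.I * 1)) φ :=
    ((Complex.ofRealCLM.hasDerivAt (x := φ)).const_mul Complex.I).cexp
  refine (h.const_mul _).congr_deriv ?_
  rw [polarPoint]; ring

theorem hasDerivAt_polarPoint_action {p J : ℝ} (hp : 0 < p) (hJ : 0 < J) (φ : ℝ) :
    HasDerivAt (fun y => polarPoint p φ y) (polarPoint p φ J * ((logDerivBeta p J : ℝ) : ℂ)) J := by
  have h := (hasDerivAt_beta hp hJ).ofReal_comp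
  refine (h.mul_const (Complex.exp (Complex.I * φ))).congr_deriv ?_
  rw [polarPoint]; push_cast; ring

theorem differentiableAt_polarPoint {p : ℝ} (hp : 0 < p) {x : ℝ × ℝ} (hx : 0 < x.2) :
    DifferentiableAt ℝ (fun y : ℝ × ℝ => polarPoint p y.1 y.2) x := by
  have h1 : DifferentiableAt ℝ (fun y : ℝ × ℝ => ((beta p y.2 : ℝ) : ℂ)) x :=
    Complex.ofRealCLM.differentiableAt.comp x
      ((hasDerivAt_beta hp hx).differentiableAt.comp x differentiableAt_snd)
  have h2 : DifferentiableAt ℝ (fun y : ℝ × ℝ => Complex.exp (Complex.I * (y.1 : ℝ))) x :=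
    ((Complex.ofRealCLM.differentiableAt.comp x differentiableAt_fst).const_mul Complex.I).cexp
  exact h1.mul h2

/-- `w H'(w)` at `w = β exp(iφ₁)`, where `S₁ = Re H(w)`. -/
def genEuler (f : C(Circ, ℝ)) (p lam φ₂ φ₁ J : ℝ) : ℂ :=
  powSum (eulerCoeff (genCoeff f lam φ₂)) (polarPoint p φ₁ J)

/-- `∂S/∂J₁`. -/
def angleMap (f : C(Circ, ℝ)) (ε p lam φ₂ φ₁ J : ℝ) : ℝ :=
  φ₁ + ε * (logDerivBeta p J * (genEuler f p lam φ₂ φ₁ J).re)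

/-- `∂S/∂φ₁`. -/
def actionMap (f : C(Circ, ℝ)) (ε p lam φ₂ φ₁ J : ℝ) : ℝ :=
  J - ε * (genEuler f p lam φ₂ φ₁ J).im

section

variable {f : C(Circ, ℝ)} {μ ν : ℕ} (hν : 0 < ν)
  (hf : Summable fun k : ℕ => (k : ℝ) * ‖coeff f (k : ℤ)‖) {p : ℝ} (hp : 0 < p)
include hν hf hp

theorem hasDerivAt_genS₁_action {J : ℝ} (hJ : 0 < J) (φ₁ φ₂ : ℝ) :
    HasDerivAt (fun y => genS₁ f p ((μ : ℝ) / ν) φ₁ φ₂ y)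
      (logDerivBeta p J * (genEuler f p ((μ : ℝ) / ν) φ₂ φ₁ J).re) J := by
  obtain ⟨C, hC⟩ := exists_norm_genCoeff_le (μ := μ) hν hf
  have h := Complex.reCLM.hasFDerivAt.comp_hasDerivAt J
    (hasDerivAt_powSum_comp (hC φ₂) (hasDerivAt_polarPoint_action hp hJ φ₁)
      (norm_polarPoint_lt_one hp hJ φ₁))
  refine (h.congr_deriv ?_).congr_of_eventuallyEq ?_
  · rw [Complex.reCLM_apply, mul_comm, Complex.re_ofReal_mul, genEuler]
  · filter_upwards [lt_mem_nhds hJ] with y hy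
    exact genS₁_eq hν hf hp hy φ₁ φ₂

theorem hasDerivAt_genS₁_angle {J : ℝ} (hJ : 0 < J) (φ₁ φ₂ : ℝ) :
    HasDerivAt (fun x => genS₁ f p ((μ : ℝ) / ν) x φ₂ J)
      (-(genEuler f p ((μ : ℝ) / ν) φ₂ φ₁ J).im) φ₁ := by
  obtain ⟨C, hC⟩ := exists_norm_genCoeff_le (μ := μ) hν hf
  have h := Complex.reCLM.hasFDerivAt.comp_hasDerivAt φ₁
    (hasDerivAt_powSum_comp (hC φ₂) (hasDerivAt_polarPoint_angle p φ₁ J)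
      (norm_polarPoint_lt_one hp hJ φ₁))
  refine (h.congr_deriv ?_).congr_of_eventuallyEq (Eventually.of_forall fun x => ?_)
  · rw [Complex.reCLM_apply, genEuler]; simp
  · exact genS₁_eq hν hf hp hJ x φ₂

theorem corresponds_iff {J₁ : ℝ} (hJ : 0 < J₁) (ε φ₁ φ₂ I₁ I₂ ψ₁ ψ₂ J₂ : ℝ) :
    Corresponds f ε p ((μ : ℝ) / ν) φ₁ φ₂ I₁ I₂ ψ₁ ψ₂ J₁ J₂ ↔
      ψ₁ = angleMap f ε p ((μ : ℝ) / ν) φ₂ φ₁ J₁ ∧ ψ₂ = φ₂ ∧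
      I₁ = actionMap f ε p ((μ : ℝ) / ν) φ₂ φ₁ J₁ ∧
      I₂ = J₂ + ε * deriv (fun x => genS₁ f p ((μ : ℝ) / ν) φ₁ x J₁) φ₂ := by
  have h1 : deriv (fun y => genS f ε p ((μ : ℝ) / ν) φ₁ φ₂ y J₂) J₁ =
      angleMap f ε p ((μ : ℝ) / ν) φ₂ φ₁ J₁ := by
    have := ((((hasDerivAt_id J₁).const_mul φ₁).add_const (φ₂ * J₂)).add
      ((hasDerivAt_genS₁_action (μ := μ) hν hf hp hJ φ₁ φ₂).const_mul ε)).deriv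
    rw [mul_one] at this
    exact this
  have h2 : deriv (fun y => genS f ε p ((μ : ℝ) / ν) φ₁ φ₂ J₁ y) J₂ = φ₂ := by
    have := ((((hasDerivAt_id J₂).const_mul φ₂).const_add (φ₁ * J₁)).add_const
      (ε * genS₁ f p ((μ : ℝ) / ν) φ₁ φ₂ J₁)).deriv
    rw [mul_one] at this
    exact this
  have h3 : deriv (fun x => genS f ε p ((μ : ℝ) / ν) x φ₂ J₁ J₂) φ₁ =
      actionMap f ε p ((μ : ℝ) / ν) φ₂ φ₁ J₁ := by
    have := ((((hasDerivAt_id φ₁).mul_const J₁).add_const (φ₂ * J₂)).add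
      ((hasDerivAt_genS₁_angle (μ := μ) hν hf hp hJ φ₁ φ₂).const_mul ε)).deriv
    rw [one_mul, mul_neg, ← sub_eq_add_neg] at this
    exact this
  have h4 : deriv (fun x => genS f ε p ((μ : ℝ) / ν) φ₁ x J₁ J₂) φ₂ =
      J₂ + ε * deriv (fun x => genS₁ f p ((μ : ℝ) / ν) φ₁ x J₁) φ₂ := by
    have := ((((hasDerivAt_id φ₂).mul_const J₂).const_add (φ₁ * J₁)).add
      ((differentiableAt_genS₁_snd (μ := μ) hν hf hp hJ φ₁ φ₂).hasDerivAt.const_mul ε)).deriv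
    rw [one_mul] at this
    exact this
  constructor
  · rintro ⟨e1, e2, e3, e4⟩
    exact ⟨e1.trans h1, e2.trans h2, e3.trans h3, e4.trans h4⟩
  · rintro ⟨e1, e2, e3, e4⟩
    exact ⟨e1.trans h1.symm, e2.trans h2.symm, e3.trans h3.symm, e4.trans h4.symm⟩

theorem differentiableAt_genEuler (φ₂ : ℝ) {x : ℝ × ℝ} (hx : 0 < x.2) :
    DifferentiableAt ℝ (fun y : ℝ × ℝ => genEuler f p ((μ : ℝ) / ν) φ₂ y.1 y.2) x := by
  obtain ⟨C, hC⟩ := exists_norm_genCoeff_le (μ := μ) hν hf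
  have h := ((differentiableOn_powSum_eulerCoeff (hC φ₂)).differentiableAt
    (Metric.isOpen_ball.mem_nhds (mem_ball_zero_iff.2
      (norm_polarPoint_lt_one hp hx x.1)))).restrictScalars ℝ
  exact h.comp x (differentiableAt_polarPoint hp hx)

theorem differentiableAt_actionMap (ε φ₂ : ℝ) {x : ℝ × ℝ} (hx : 0 < x.2) :
    DifferentiableAt ℝ (fun y : ℝ × ℝ => actionMap f ε p ((μ : ℝ) / ν) φ₂ y.1 y.2) x :=
  differentiableAt_snd.sub ((Complex.imCLM.differentiableAt.comp x
    (differentiableAt_genEuler hν hf hp φ₂ hx)).const_mul ε)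

theorem differentiableAt_angleMap (ε φ₂ : ℝ) {x : ℝ × ℝ} (hx : 0 < x.2) :
    DifferentiableAt ℝ (fun y : ℝ × ℝ => angleMap f ε p ((μ : ℝ) / ν) φ₂ y.1 y.2) x := by
  have h : DifferentiableAt ℝ (logDerivBeta p) x.2 := by
    unfold logDerivBeta
    have : 2 * x.2 * (x.2 + p) ≠ 0 := by positivity
    fun_prop (disch := assumption)
  exact differentiableAt_fst.add (((h.comp x differentiableAt_snd).mul
    (Complex.reCLM.differentiableAt.comp x
      (differentiableAt_genEuler hν hf hp φ₂ hx))).const_mul ε)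

omit hp in
theorem exists_norm_genEuler_le {η : ℝ} (hη : 0 < η) :
    ∃ A, 0 ≤ A ∧ ∀ p > 0, ∀ φ₂ φ₁ J : ℝ, 0 < J →
      ‖genEuler f p ((μ : ℝ) / ν) φ₂ φ₁ J‖ ≤ A + η * (2 * (J + p) / p) := by
  obtain ⟨B, hB, hle⟩ := exists_tendsto_norm_eulerCoeff_genCoeff_le (μ := μ) hν hf
  obtain ⟨A, hA⟩ := exists_norm_powSum_le_of_tendsto_zero hB hη
  refine ⟨|A|, abs_nonneg _, fun p hp φ₂ φ₁ J hJ => ?_⟩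
  have h := hA _ (hle φ₂) (polarPoint p φ₁ J) (norm_polarPoint_lt_one hp hJ φ₁)
  refine h.trans (add_le_add (le_abs_self A) ?_)
  rw [norm_polarPoint, ← mul_one_div]
  exact mul_le_mul_of_nonneg_left (one_div_one_sub_beta_le hp hJ) hη.le

/-- The Euler derivative grows at most linearly in J, while β'/β = p / (2J(J + p)) decays
quadratically. -/
theorem exists_abs_angleMap_sub_le (ε : ℝ) : ∃ A, 0 ≤ A ∧ ∀ φ₂ φ₁ J : ℝ, 0 < J →
    |angleMap f ε p ((μ : ℝ) / ν) φ₂ φ₁ J - φ₁| ≤ A / J := by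
  obtain ⟨A, hA0, hA⟩ := exists_norm_genEuler_le (μ := μ) hν hf one_pos
  refine ⟨|ε| * (A + 1), by positivity, fun φ₂ φ₁ J hJ => ?_⟩
  rw [angleMap, add_sub_cancel_left, abs_mul, abs_mul, abs_of_pos (logDerivBeta_pos hp hJ),
    mul_div_assoc]
  refine mul_le_mul_of_nonneg_left ?_ (abs_nonneg _)
  have h1 := (Complex.abs_re_le_norm _).trans (hA p hp φ₂ φ₁ J hJ)
  calc _ ≤ logDerivBeta p J * (A + 1 * (2 * (J + p) / p)) :=
        mul_le_mul_of_nonneg_left h1 (logDerivBeta_pos hp hJ).le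
    _ = A / J * (p / (2 * (J + p))) + 1 / J := by rw [logDerivBeta]; field_simp
    _ ≤ A / J * 1 + 1 / J := by
        gcongr
        rw [div_le_one (by positivity)]; linarith
    _ = (A + 1) / J := by ring

theorem exists_abs_actionMap_sub_le (ε : ℝ) {η : ℝ} (hη : 0 < η) :
    ∃ A, ∀ φ₂ φ₁ J : ℝ, 0 < J →
      |actionMap f ε p ((μ : ℝ) / ν) φ₂ φ₁ J - J| ≤ A + η * J := by
  -- Chosen so that (|ε| + 1) δ · 2(J + p)/p = η(J + p); the summand 1 keeps the denominator
  -- positive.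
  set δ := η * p / (2 * (|ε| + 1)) with hδ
  have hε : 0 < |ε| + 1 := by positivity
  obtain ⟨A, hA0, hA⟩ := exists_norm_genEuler_le (μ := μ) hν hf (η := δ) (by positivity)
  refine ⟨(|ε| + 1) * A + η * p, fun φ₂ φ₁ J hJ => ?_⟩
  have h1 := (Complex.abs_im_le_norm _).trans (hA p hp φ₂ φ₁ J hJ)
  rw [actionMap, sub_sub_cancel_left, abs_neg, abs_mul]
  calc |ε| * _ ≤ (|ε| + 1) * (A + δ * (2 * (J + p) / p)) := by
        gcongr
        linarith
    _ = (|ε| + 1) * A + η * p + η * J := by rw [hδ]; field_simp; ring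

theorem exists_abs_actionMap_sub_le_beta (ε φ₂ : ℝ) :
    ∃ A, ∀ φ₁ J : ℝ, 0 < J →
      |actionMap f ε p ((μ : ℝ) / ν) φ₂ φ₁ J - J| ≤ A * beta p J / (1 - beta p J) := by
  obtain ⟨B, hB, hle⟩ := exists_tendsto_norm_eulerCoeff_genCoeff_le (μ := μ) hν hf
  obtain ⟨C, hC⟩ := hB.bddAbove_range
  refine ⟨|ε| * C, fun φ₁ J hJ => ?_⟩
  have h := norm_powSum_le' (fun n => (hle φ₂ n).trans (hC ⟨n, rfl⟩))
    (by simp [eulerCoeff]) (norm_polarPoint_lt_one hp hJ φ₁)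
  rw [norm_polarPoint] at h
  rw [actionMap, sub_sub_cancel_left, abs_neg, abs_mul, mul_assoc, mul_div_assoc]
  gcongr
  exact (Complex.abs_im_le_norm _).trans h

/-- For fixed J the map is continuous and differs from the identity by a bounded amount, hence is
onto. -/
theorem exists_angleMap_eq (ε φ₂ ψ : ℝ) {J : ℝ} (hJ : 0 < J) :
    ∃ φ₁, angleMap f ε p ((μ : ℝ) / ν) φ₂ φ₁ J = ψ := by
  obtain ⟨A, -, hA⟩ := exists_abs_angleMap_sub_le (μ := μ) hν hf hp ε
  have hc : Continuous fun x : ℝ => angleMap f ε p ((μ : ℝ) / ν) φ₂ x J :=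
    continuous_iff_continuousAt.2 fun x =>
      ContinuousAt.comp (g := fun y : ℝ × ℝ => angleMap f ε p ((μ : ℝ) / ν) φ₂ y.1 y.2)
        (f := fun x : ℝ => (x, J))
        (differentiableAt_angleMap (x := (x, J)) hν hf hp ε φ₂ hJ).continuousAt (by fun_prop)
  refine hc.surjective ?_ ?_ ψ
  · exact tendsto_atTop_mono (fun x => by
      have := (abs_le.1 (hA φ₂ x J hJ)).1
      simp only [id]; linarith)
      (tendsto_atTop_add_const_right _ (-(A / J)) tendsto_id)
  · exact tendsto_atBot_mono (fun x => by
      have := (abs_le.1 (hA φ₂ x J hJ)).2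
      simp only [id]; linarith) (tendsto_atBot_add_const_right _ (A / J) tendsto_id)

/-- Intermediate values: the action map tends to 0 as J → 0 and grows at least like J/2 at infinity.
-/
theorem exists_actionMap_eq (ε φ₂ φ₁ : ℝ) {x : ℝ} (hx : 0 < x) :
    ∃ J, 0 < J ∧ actionMap f ε p ((μ : ℝ) / ν) φ₂ φ₁ J = x := by
  have hc : ContinuousOn (fun y : ℝ => actionMap f ε p ((μ : ℝ) / ν) φ₂ φ₁ y) (Set.Ioi 0) := by
    intro y hy
    exact (ContinuousAt.comp
      (g := fun y : ℝ × ℝ => actionMap f ε p ((μ : ℝ) / ν) φ₂ y.1 y.2) (f := fun y : ℝ => (φ₁, y))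
      (differentiableAt_actionMap (x := (φ₁, y)) hν hf hp ε φ₂ hy).continuousAt
        (by fun_prop)).continuousWithinAt
  have hlow : ∃ a ∈ Set.Ioi (0 : ℝ), actionMap f ε p ((μ : ℝ) / ν) φ₂ φ₁ a ≤ x := by
    obtain ⟨A, hA⟩ := exists_abs_actionMap_sub_le_beta (μ := μ) hν hf hp ε φ₂
    have hb : ContinuousAt (beta p) 0 := by
      unfold beta
      have : (0 : ℝ) + p ≠ 0 := by simpa using hp.ne'
      fun_prop (disch := assumption)
    have hlim : Tendsto (fun y => y + A * beta p y / (1 - beta p y)) (𝓝[>] 0) (𝓝 0) := by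
      have h0 : beta p 0 = 0 := by simp [beta]
      have h1 : ContinuousAt (fun y => y + A * beta p y / (1 - beta p y)) 0 := by
        have : 1 - beta p 0 ≠ 0 := by simp [h0]
        fun_prop (disch := assumption)
      have h2 := h1.tendsto
      simp only [h0, mul_zero, zero_div, add_zero] at h2
      exact h2.mono_left nhdsWithin_le_nhds
    obtain ⟨a, ha, ha0⟩ := ((hlim.eventually (gt_mem_nhds hx)).and self_mem_nhdsWithin).exists
    exact ⟨a, ha0, by linarith [(abs_le.1 (hA φ₁ a ha0)).2]⟩
  have hhigh : ∃ b ∈ Set.Ioi (0 : ℝ), x ≤ actionMap f ε p ((μ : ℝ) / ν) φ₂ φ₁ b := by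
    obtain ⟨A, hA⟩ := exists_abs_actionMap_sub_le (μ := μ) hν hf hp ε (η := 1 / 2) (by norm_num)
    -- At this J the lower bound J/2 - A equals x + |A| - A ≥ x.
    have hpos : 0 < 2 * (x + |A|) := by positivity
    refine ⟨2 * (x + |A|), hpos, ?_⟩
    have := (abs_le.1 (hA φ₂ φ₁ _ hpos)).1
    linarith [le_abs_self A]
  obtain ⟨a, ha, hax⟩ := hlow
  obtain ⟨b, hb, hbx⟩ := hhigh
  obtain ⟨J, hJ, h⟩ := isPreconnected_Ioi.intermediate_value ha hb hc ⟨hax, hbx⟩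
  exact ⟨J, hJ, h⟩

end

/-! ### Almost every initial point lies on a noncritical level -/

theorem exists_diskPoint_eq (m : ℕ) (p J : ℝ) {z : ℂ} (hz : ‖z‖ = beta p J ^ m) :
    ∃ θ, diskPoint m p θ J = z := by
  refine ⟨(z * (-Complex.I) ^ m).arg, ?_⟩
  have h := Complex.norm_mul_exp_arg_mul_I (z * (-Complex.I) ^ m)
  have hn : ‖z * (-Complex.I) ^ m‖ = beta p J ^ m := by simp [hz]
  rw [hn, mul_comm _ Complex.I] at h
  rw [diskPoint, mul_assoc, ← Complex.ofReal_pow, h, mul_left_comm, ← mul_pow]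
  simp

theorem continuousAt_diskPoint (m : ℕ) {p : ℝ} (hp : 0 < p) {x : ℝ × ℝ} (hx : 0 < x.2) :
    ContinuousAt (fun y : ℝ × ℝ => diskPoint m p y.1 y.2) x := by
  have h : ContinuousAt (fun y : ℝ × ℝ => beta p y.2) x :=
    (hasDerivAt_beta hp hx).continuousAt.comp continuousAt_snd
  unfold diskPoint
  have h2 : ContinuousAt (fun y : ℝ × ℝ => ((beta p y.2 : ℝ) : ℂ)) x :=
    Complex.continuous_ofReal.continuousAt.comp h
  exact (continuousAt_const.mul (h2.pow m)).mul (by fun_prop)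

section

variable {b : ℕ → ℂ} (hb : Summable fun n => ‖eulerCoeff b n‖) (b0 : b 0 = 0)
  {f : C(Circ, ℝ)} {μ ν : ℕ} (hμ : 0 < μ) (hν : 0 < ν)
  (hf : Summable fun k : ℕ => (k : ℝ) * ‖coeff f (k : ℤ)‖) {p : ℝ} (hp : 0 < p)
include hb b0 hμ hν hf hp

/-- The value of `Re P` at the point with original coordinates `(φ₁, φ₂)`, up to the choice of `J`,
for `φ₂ = 0`. -/
def initialLevel (b : ℕ → ℂ) (f : C(Circ, ℝ)) (ε p : ℝ) (μ ν : ℕ) (x : ℝ × ℝ) : ℝ :=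
  (powSum b (diskPoint μ p (μ * angleMap f ε p ((μ : ℝ) / ν) 0 x.1 x.2) x.2)).re

theorem continuousAt_initialLevel (ε : ℝ) {x : ℝ × ℝ} (hx : 0 < x.2) :
    ContinuousAt (initialLevel b f ε p μ ν) x := by
  have h1 := (differentiableAt_angleMap (μ := μ) hν hf hp ε 0 hx).continuousAt
  have h2 : ContinuousAt (fun y : ℝ × ℝ =>
      (μ * angleMap f ε p ((μ : ℝ) / ν) 0 y.1 y.2, y.2)) x :=
    (continuousAt_const.mul h1).prodMk continuousAt_snd
  have h3 := ContinuousAt.comp (g := fun y : ℝ × ℝ => diskPoint μ p y.1 y.2)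
    (f := fun y : ℝ × ℝ => (μ * angleMap f ε p ((μ : ℝ) / ν) 0 y.1 y.2, y.2))
    (continuousAt_diskPoint μ hp hx) h2
  have h4 := ((differentiableOn_powSum (norm_le_tsum_eulerCoeff hb b0)).differentiableAt
    (Metric.isOpen_ball.mem_nhds (mem_ball_zero_iff.2
      (norm_diskPoint_lt_one hμ hp hx (μ * angleMap f ε p ((μ : ℝ) / ν) 0 x.1 x.2))))).continuousAt
  exact Complex.continuous_re.continuousAt.comp
    (ContinuousAt.comp (g := powSum b) h4 h3)

omit hb b0 hμ hν hf hp in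
theorem analyticAt_exp_I_mul_ofReal (x : ℝ) :
    AnalyticAt ℝ (fun y : ℝ => Complex.exp (Complex.I * y)) x :=
  (analyticAt_cexp.restrictScalars (𝕜 := ℝ)).comp
    (analyticAt_const.mul (Complex.ofRealCLM.analyticAt x))

omit hb b0 hμ in
theorem analyticAt_angleMap (ε φ₂ φ₁ : ℝ) {J : ℝ} (hJ : 0 < J) :
    AnalyticAt ℝ (fun x => angleMap f ε p ((μ : ℝ) / ν) φ₂ x J) φ₁ := by
  obtain ⟨C, hC⟩ := exists_norm_genCoeff_le (μ := μ) hν hf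
  have h1 : AnalyticAt ℝ (fun x => polarPoint p x J) φ₁ :=
    analyticAt_const.mul (analyticAt_exp_I_mul_ofReal φ₁)
  have h2 := ((differentiableOn_powSum_eulerCoeff (hC φ₂)).analyticAt
    (Metric.isOpen_ball.mem_nhds (mem_ball_zero_iff.2
      (norm_polarPoint_lt_one hp hJ φ₁)))).restrictScalars (𝕜 := ℝ)
  exact analyticAt_id.add (analyticAt_const.mul (analyticAt_const.mul
    ((Complex.reCLM.analyticAt _).comp
      (AnalyticAt.comp (f := fun x => polarPoint p x J) h2 h1))))

theorem analyticAt_initialLevel (ε φ₁ : ℝ) {J : ℝ} (hJ : 0 < J) :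
    AnalyticAt ℝ (fun x => initialLevel b f ε p μ ν (x, J)) φ₁ := by
  have h1 : AnalyticAt ℝ (fun x => diskPoint μ p (μ * angleMap f ε p ((μ : ℝ) / ν) 0 x J) J) φ₁ :=
    analyticAt_const.mul (AnalyticAt.comp (analyticAt_exp_I_mul_ofReal _)
      (f := fun x => (μ : ℝ) * angleMap f ε p ((μ : ℝ) / ν) 0 x J)
      (analyticAt_const.mul (analyticAt_angleMap hν hf hp ε 0 φ₁ hJ)))
  have h2 := ((differentiableOn_powSum (norm_le_tsum_eulerCoeff hb b0)).analyticAt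
    (Metric.isOpen_ball.mem_nhds (mem_ball_zero_iff.2
      (norm_diskPoint_lt_one hμ hp hJ (μ * angleMap f ε p ((μ : ℝ) / ν) 0 φ₁ J))))).restrictScalars
      (𝕜 := ℝ)
  exact (Complex.reCLM.analyticAt _).comp (AnalyticAt.comp
    (f := fun x => diskPoint μ p (μ * angleMap f ε p ((μ : ℝ) / ν) 0 x J) J) h2 h1)

/-- The angle map is onto for fixed J, so a constant level would make Re P constant on the whole
circle of radius β^μ. -/
theorem exists_deriv_initialLevel_ne_zero (hne : b ≠ 0) (ε : ℝ) {J : ℝ} (hJ : 0 < J) :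
    ∃ x, deriv (fun x => initialLevel b f ε p μ ν (x, J)) x ≠ 0 := by
  by_contra! h
  have hd : Differentiable ℝ fun x => initialLevel b f ε p μ ν (x, J) := fun x =>
    (analyticAt_initialLevel hb b0 hμ hν hf hp ε x hJ).differentiableAt
  have hconst := is_const_of_deriv_eq_zero hd h
  have hβ := beta_pos hp hJ
  refine not_re_powSum_const_on_sphere hb b0 hne (r := beta p J ^ μ) (by positivity)
    (pow_lt_one₀ hβ.le (beta_lt_one hp hJ) hμ.ne') (initialLevel b f ε p μ ν (0, J)) fun z hz => ?_
  obtain ⟨θ, rfl⟩ := exists_diskPoint_eq μ p J hz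
  obtain ⟨x, hx⟩ := exists_angleMap_eq (μ := μ) hν hf hp ε 0 (θ / μ) hJ
  rw [hconst 0 x]
  have hμ' : (μ : ℝ) ≠ 0 := by exact_mod_cast hμ.ne'
  rw [initialLevel, hx, mul_div_cancel₀ _ hμ']

theorem volume_initialLevel_mem_eq_zero (hne : b ≠ 0) (ε : ℝ) {N : Set ℝ} (hN : volume N = 0) :
    volume {x : ℝ × ℝ | 0 < x.2 ∧ initialLevel b f ε p μ ν x ∈ N} = 0 := by
  -- Fubini needs a measurable set, so N is enlarged to a measurable null set.
  set N' := toMeasurable volume N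
  have hN' : volume N' = 0 := by rw [measure_toMeasurable, hN]
  have hs : MeasurableSet {x : ℝ × ℝ | 0 < x.2} := measurableSet_lt measurable_const measurable_snd
  have hcont : ContinuousOn (initialLevel b f ε p μ ν) {x : ℝ × ℝ | 0 < x.2} := fun x hx =>
    (continuousAt_initialLevel hb b0 hμ hν hf hp ε hx).continuousWithinAt
  classical
  have hmeas : Measurable ({x : ℝ × ℝ | 0 < x.2}.piecewise (initialLevel b f ε p μ ν) 0) :=
    hcont.measurable_piecewise continuousOn_const hs
  set T : Set (ℝ × ℝ) := {x | 0 < x.2 ∧ initialLevel b f ε p μ ν x ∈ N'} with hT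
  have hTm : MeasurableSet T := by
    have e : T = {x : ℝ × ℝ | 0 < x.2} ∩
        {x : ℝ × ℝ | 0 < x.2}.piecewise (initialLevel b f ε p μ ν) 0 ⁻¹' N' := by
      ext x
      constructor
      · rintro ⟨h1, h2⟩
        refine ⟨h1, ?_⟩
        rw [Set.mem_preimage, Set.piecewise_eq_of_mem {x : ℝ × ℝ | 0 < x.2} _ _ h1]
        exact h2
      · rintro ⟨h1, h2⟩
        refine ⟨h1, ?_⟩
        rwa [Set.mem_preimage, Set.piecewise_eq_of_mem {x : ℝ × ℝ | 0 < x.2} _ _ h1] at h2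
    rw [e]
    exact hs.inter (hmeas (measurableSet_toMeasurable _ _))
  refine measure_mono_null (t := T) (fun x hx => ⟨hx.1, subset_toMeasurable _ _ hx.2⟩) ?_
  -- The coordinates are swapped so that the slices have J fixed, where the level is analytic in φ₁.
  rw [Measure.volume_eq_prod, ← Measure.prod_swap, Measure.map_apply measurable_swap hTm,
    Measure.measure_prod_null (measurable_swap hTm)]
  refine Eventually.of_forall fun J => ?_
  by_cases hJ : 0 < J
  · obtain ⟨x, hx⟩ := exists_deriv_initialLevel_ne_zero hb b0 hμ hν hf hp hne ε hJ
    exact measure_mono_null (fun y hy => hy.2) (volume_preimage_eq_zero_of_analytic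
      (fun y _ => analyticAt_initialLevel hb b0 hμ hν hf hp ε y hJ) hx hN')
  · exact measure_mono_null (t := ∅) (fun y hy => hJ hy.1) measure_empty

/-- The map (φ₁, J) ↦ (φ₁, I₁) is differentiable, so it sends null sets to null sets. It need not be
injective: every J over the given data is treated at once. -/
theorem ae_initialLevel_notMem (hne : b ≠ 0) (ε : ℝ) {N : Set ℝ} (hN : volume N = 0) :
    ∀ᵐ x : ℝ × ℝ, ∀ J, 0 < J → actionMap f ε p ((μ : ℝ) / ν) 0 x.1 J = x.2 →
      initialLevel b f ε p μ ν (x.1, J) ∉ N := by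
  have h0 := volume_initialLevel_mem_eq_zero hb b0 hμ hν hf hp hne ε hN
  have h1 : DifferentiableOn ℝ (fun y : ℝ × ℝ => (y.1, actionMap f ε p ((μ : ℝ) / ν) 0 y.1 y.2))
      {x : ℝ × ℝ | 0 < x.2 ∧ initialLevel b f ε p μ ν x ∈ N} := fun x hx =>
    (differentiableAt_fst.prodMk
      (differentiableAt_actionMap hν hf hp ε 0 hx.1)).differentiableWithinAt
  have h2 := addHaar_image_eq_zero_of_differentiableOn_of_addHaar_eq_zero volume h1 h0
  filter_upwards [compl_mem_ae_iff.2 h2] with x hx J hJ hxJ hmem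
  exact hx ⟨(x.1, J), ⟨hJ, hmem⟩, Prod.ext rfl hxJ⟩

end

/-! ### The slow flow and its asymptotics -/

theorem hasDerivWithinAt_powSum_comp {c : ℕ → ℂ} {C : ℝ} (hc : ∀ n, ‖c n‖ ≤ C) {w : ℝ → ℂ}
    {s : Set ℝ} {x : ℝ} {l : ℂ} (hw : HasDerivWithinAt w (w x * l) s x) (hx : ‖w x‖ < 1) :
    HasDerivWithinAt (fun y => powSum c (w y)) (powSum (eulerCoeff c) (w x) * l) s x := by
  have h := ((differentiableOn_powSum hc).differentiableAt (Metric.isOpen_ball.mem_nhds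
    (mem_ball_zero_iff.2 hx))).hasDerivAt.comp_hasDerivWithinAt x hw
  refine h.congr_deriv ?_
  rw [powSum_eulerCoeff hc hx]; ring

theorem hasDerivWithinAt_diskPoint (m : ℕ) {p : ℝ} (hp : 0 < p) {θ J : ℝ → ℝ} {s : Set ℝ}
    {t θ' J' : ℝ} (hθ : HasDerivWithinAt θ θ' s t) (hJ' : HasDerivWithinAt J J' s t)
    (hJ : 0 < J t) :
    HasDerivWithinAt (fun t => diskPoint m p (θ t) (J t)) (diskPoint m p (θ t) (J t) *
      ((m * logDerivBeta p (J t) * J' : ℝ) + Complex.I * θ')) s t := by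
  have h1 : HasDerivWithinAt (fun t => ((beta p (J t) : ℝ) : ℂ) ^ m)
      (((beta p (J t) : ℝ) : ℂ) ^ m * ((m * logDerivBeta p (J t) : ℝ) : ℂ) * J') s t := by
    have := (hasDerivAt_ofReal_beta_pow hp hJ m).scomp_hasDerivWithinAt t hJ'
    refine this.congr_deriv ?_
    rw [Complex.real_smul, mul_comm]
  have h2 : HasDerivWithinAt (fun t => Complex.exp (Complex.I * (θ t : ℝ)))
      (Complex.exp (Complex.I * (θ t : ℝ)) * (Complex.I * θ')) s t :=
    (hθ.ofReal_comp.const_mul Complex.I).cexp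
  refine ((h1.const_mul (Complex.I ^ m)).mul h2).congr_deriv ?_
  rw [diskPoint]; push_cast; ring

/-- `f t / t` converges to the limit of the derivative of `f`. -/
theorem tendsto_div_of_tendsto_deriv {g g' : ℝ → ℝ} {C : ℝ}
    (hg : ∀ t, 0 < t → HasDerivAt g (g' t) t) (hC : Tendsto g' atTop (𝓝 C)) :
    Tendsto (fun t => g t / t) atTop (𝓝 C) := by
  rw [Metric.tendsto_atTop]
  intro η hη
  obtain ⟨T₀, hT₀⟩ := Metric.tendsto_atTop.1 hC (η / 2) (by positivity)
  -- Past T > 0 the function g(s) - Cs has slope at most η/2; the second bound on t makes its value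
  -- at T smaller than ηt/2.
  set T := max T₀ 1 with hT
  have hT0 : 0 < T := lt_of_lt_of_le one_pos (le_max_right _ _)
  refine ⟨max (T + 1) (2 * |g T - C * T| / η + 1), fun t ht => ?_⟩
  have htT : T + 1 ≤ t := (le_max_left _ _).trans ht
  have ht2 : 2 * |g T - C * T| / η + 1 ≤ t := (le_max_right _ _).trans ht
  have ht0 : 0 < t := by linarith
  have h := Convex.norm_image_sub_le_of_norm_hasDerivWithin_le (f := fun s => g s - C * s)
    (f' := fun s => g' s - C) (s := Set.Ici T) (C := η / 2) (x := T) (y := t)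
    (fun s hs => (((hg s (hT0.trans_le hs)).sub
      (((hasDerivAt_id s).const_mul C).congr_deriv (mul_one C)))).hasDerivWithinAt)
    (fun s hs => by
      have := hT₀ s ((le_max_left _ _).trans hs)
      rw [Real.dist_eq] at this
      exact this.le) (convex_Ici T) Set.self_mem_Ici (Set.mem_Ici.2 (by linarith))
  simp only [Real.norm_eq_abs] at h
  have e : g t / t - C = (g t - C * t) / t := by field_simp
  rw [Real.dist_eq, e, abs_div, abs_of_pos ht0, div_lt_iff₀ ht0]
  have h3 : |g t - C * t| ≤ |g t - C * t - (g T - C * T)| + |g T - C * T| := by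
    have := abs_add_le (g t - C * t - (g T - C * T)) (g T - C * T)
    rwa [sub_add_cancel] at this
  rw [abs_of_pos (by linarith : 0 < t - T)] at h
  have h4 : |g T - C * T| < η / 2 * t := by
    have : 2 * |g T - C * T| / η < t := by linarith
    rw [div_lt_iff₀ hη] at this
    linarith
  nlinarith

/-- A solution of the averaged equations for the slow angle `θ = μψ₁ - νψ₂` and `J = J₁`. -/
structure IsSlowSolution (b : ℕ → ℂ) (κ p : ℝ) (μ : ℕ) (θ J : ℝ → ℝ) : Prop where
  pos : ∀ t, 0 ≤ t → 0 < J t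
  angle : ∀ t, 0 ≤ t → HasDerivWithinAt θ (-κ * (μ * logDerivBeta p (J t)) *
    (powSum (eulerCoeff b) (diskPoint μ p (θ t) (J t))).re) (Set.Ici 0) t
  action : ∀ t, 0 ≤ t → HasDerivWithinAt J (-κ *
    (powSum (eulerCoeff b) (diskPoint μ p (θ t) (J t))).im) (Set.Ici 0) t

/-- The conservation law, and the monotonicity of the conjugate function. -/
theorem hasDerivWithinAt_powSum_of_slow {b : ℕ → ℂ} {C : ℝ} (hC : ∀ n, ‖b n‖ ≤ C) {κ p : ℝ}
    {μ : ℕ} (hμ : 0 < μ) (hp : 0 < p) {θ J : ℝ → ℝ} {s : Set ℝ} {t χ : ℝ} (hJ : 0 < J t)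
    (hθ : HasDerivWithinAt θ (χ * (-κ * (μ * logDerivBeta p (J t)) *
      (powSum (eulerCoeff b) (diskPoint μ p (θ t) (J t))).re)) s t)
    (hJ' : HasDerivWithinAt J (χ * (-κ *
      (powSum (eulerCoeff b) (diskPoint μ p (θ t) (J t))).im)) s t) :
    HasDerivWithinAt (fun t => powSum b (diskPoint μ p (θ t) (J t)))
      (((-χ * κ * (μ * logDerivBeta p (J t)) *
        ‖powSum (eulerCoeff b) (diskPoint μ p (θ t) (J t))‖ ^ 2 : ℝ) : ℂ) * Complex.I) s t := by
  refine (hasDerivWithinAt_powSum_comp hC (hasDerivWithinAt_diskPoint μ hp hθ hJ' hJ)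
    (norm_diskPoint_lt_one hμ hp hJ _)).congr_deriv ?_
  set d := powSum (eulerCoeff b) (diskPoint μ p (θ t) (J t))
  rw [← Complex.normSq_eq_norm_sq, Complex.normSq_apply]
  apply Complex.ext
  · simp; ring
  · simp; ring

theorem mul_sub_le_of_hasDerivWithinAt_Ici {g g' : ℝ → ℝ}
    (hg : ∀ t, 0 ≤ t → HasDerivWithinAt g (g' t) (Set.Ici 0) t) {a b m : ℝ} (ha : 0 ≤ a)
    (hab : a ≤ b) (hm : ∀ t ∈ Set.Icc a b, m ≤ g' t) : m * (b - a) ≤ g b - g a := by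
  have hd : ∀ t ∈ interior (Set.Icc a b), HasDerivAt g (g' t) t := by
    intro t ht
    rw [interior_Icc] at ht
    exact (hg t (ha.trans ht.1.le)).hasDerivAt (Ici_mem_nhds (ha.trans_lt ht.1))
  refine (convex_Icc a b).mul_sub_le_image_sub_of_le_deriv
    (fun t ht => ((hg t (ha.trans ht.1)).continuousWithinAt.mono
      (fun s hs => ha.trans hs.1)))
    (fun t ht => (hd t ht).differentiableAt.differentiableWithinAt) (fun t ht => ?_)
    a (Set.left_mem_Icc.2 hab) b (Set.right_mem_Icc.2 hab) hab
  rw [(hd t ht).deriv]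
  exact hm t (interior_subset ht)

theorem logDerivBeta_antitone {p x y : ℝ} (hp : 0 < p) (hx : 0 < x) (hxy : x ≤ y) :
    logDerivBeta p y ≤ logDerivBeta p x := by
  have hy := hx.trans_le hxy
  unfold logDerivBeta
  gcongr

theorem beta_mono {p x y : ℝ} (hp : 0 < p) (hx : 0 < x) (hxy : x ≤ y) :
    beta p x ≤ beta p y := by
  unfold beta
  apply Real.sqrt_le_sqrt
  rw [div_le_div_iff₀ (by positivity) (by linarith)]
  nlinarith

namespace IsSlowSolution

variable {b : ℕ → ℂ} {κ p : ℝ} {μ : ℕ} {θ J : ℝ → ℝ}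

theorem hasDerivWithinAt_powSum (h : IsSlowSolution b κ p μ θ J) {C : ℝ} (hC : ∀ n, ‖b n‖ ≤ C)
    (hμ : 0 < μ) (hp : 0 < p) {t : ℝ} (ht : 0 ≤ t) :
    HasDerivWithinAt (fun t => powSum b (diskPoint μ p (θ t) (J t)))
      (((-κ * (μ * logDerivBeta p (J t)) *
        ‖powSum (eulerCoeff b) (diskPoint μ p (θ t) (J t))‖ ^ 2 : ℝ) : ℂ) * Complex.I)
      (Set.Ici 0) t := by
  have := hasDerivWithinAt_powSum_of_slow (χ := 1) (κ := κ) hC hμ hp (h.pos t ht)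
    (by simpa using h.angle t ht) (by simpa using h.action t ht)
  simpa only [neg_one_mul] using this

theorem re_powSum_eq (h : IsSlowSolution b κ p μ θ J) {C : ℝ} (hC : ∀ n, ‖b n‖ ≤ C)
    (hμ : 0 < μ) (hp : 0 < p) {t : ℝ} (ht : 0 ≤ t) :
    (powSum b (diskPoint μ p (θ t) (J t))).re = (powSum b (diskPoint μ p (θ 0) (J 0))).re := by
  have hd : ∀ t, 0 ≤ t → HasDerivWithinAt (fun t => (powSum b (diskPoint μ p (θ t) (J t))).re)
      0 (Set.Ici 0) t := fun t ht =>
    (Complex.reCLM.hasFDerivAt.comp_hasDerivWithinAt t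
      (h.hasDerivWithinAt_powSum hC hμ hp ht)).congr_deriv (by
        simp [-Complex.ofReal_neg, -Complex.ofReal_mul])
  have hd' : ∀ t, 0 ≤ t → HasDerivWithinAt (fun t => -(powSum b (diskPoint μ p (θ t) (J t))).re)
      0 (Set.Ici 0) t := fun t ht => (hd t ht).neg.congr_deriv neg_zero
  have h1 := mul_sub_le_of_hasDerivWithinAt_Ici hd le_rfl ht (m := 0) fun _ _ => le_rfl
  have h2 := mul_sub_le_of_hasDerivWithinAt_Ici hd' le_rfl ht (m := 0) fun _ _ => le_rfl
  linarith

theorem hasDerivWithinAt_im_powSum (h : IsSlowSolution b κ p μ θ J) {C : ℝ} (hC : ∀ n, ‖b n‖ ≤ C)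
    (hμ : 0 < μ) (hp : 0 < p) {t : ℝ} (ht : 0 ≤ t) :
    HasDerivWithinAt (fun t => -(powSum b (diskPoint μ p (θ t) (J t))).im)
      (κ * (μ * logDerivBeta p (J t)) *
        ‖powSum (eulerCoeff b) (diskPoint μ p (θ t) (J t))‖ ^ 2) (Set.Ici 0) t := by
  have h1 := (Complex.imCLM.hasFDerivAt.comp_hasDerivWithinAt t
    (h.hasDerivWithinAt_powSum hC hμ hp ht)).neg
  refine h1.congr_deriv ?_
  simp [-Complex.ofReal_neg, -Complex.ofReal_mul]

variable (h : IsSlowSolution b κ p μ θ J) (hb : Summable fun n => ‖eulerCoeff b n‖) (b0 : b 0 = 0)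
  (hκ : 0 < κ) (hp : 0 < p) (hμ : 0 < μ)
  (hc : (powSum b (diskPoint μ p (θ 0) (J 0))).re ∉ criticalLevels b)
include h hb b0 hκ hp hμ hc

/-- Were J bounded, the orbit would stay in a compact part of the level inside the open disk. There
|D| has a positive minimum, so -Im P grows at least linearly, although P is bounded. -/
theorem not_bounded (m : ℝ) : ∃ t, 0 ≤ t ∧ m < J t := by
  by_contra! hm
  have hC := norm_le_tsum_eulerCoeff hb b0
  have hm0 : 0 < m := (h.pos 0 le_rfl).trans_le (hm 0 le_rfl)
  set r := beta p m ^ μ with hr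
  have hr1 : r < 1 := pow_lt_one₀ (beta_nonneg p m) (beta_lt_one hp hm0) hμ.ne'
  set c := (powSum b (diskPoint μ p (θ 0) (J 0))).re with hcdef
  have hsub : Metric.closedBall (0 : ℂ) r ⊆ Metric.closedBall 0 1 :=
    Metric.closedBall_subset_closedBall hr1.le
  have hcontP := (continuousOn_powSum_closedBall (summable_norm_of_eulerCoeff hb b0)).mono hsub
  have hcontD := (continuousOn_powSum_closedBall hb).mono hsub
  set E : Set ℂ := Metric.closedBall 0 r ∩ (fun z => (powSum b z).re) ⁻¹' {c} with hE
  have hEc : IsCompact E := (isCompact_closedBall 0 r).of_isClosed_subset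
    ((Complex.continuous_re.comp_continuousOn hcontP).preimage_isClosed_of_isClosed
      Metric.isClosed_closedBall isClosed_singleton) Set.inter_subset_left
  have hmem : ∀ t, 0 ≤ t → diskPoint μ p (θ t) (J t) ∈ E := fun t ht => by
    refine ⟨mem_closedBall_zero_iff.2 ?_, h.re_powSum_eq hC hμ hp ht⟩
    rw [norm_diskPoint]
    exact pow_le_pow_left₀ (beta_nonneg _ _) (beta_mono hp (h.pos t ht) (hm t ht)) _
  obtain ⟨z₀, hz₀, hmin⟩ := hEc.exists_isMinOn ⟨_, hmem 0 le_rfl⟩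
    (hcontD.mono Set.inter_subset_left).norm
  have hδ : 0 < ‖powSum (eulerCoeff b) z₀‖ := by
    rw [norm_pos_iff]
    intro h0
    exact hc ⟨z₀, hz₀.2, Or.inl ⟨(mem_closedBall_zero_iff.1 hz₀.1).trans_lt hr1, h0⟩⟩
  set δ := ‖powSum (eulerCoeff b) z₀‖
  set q := κ * (μ * logDerivBeta p m) * δ ^ 2 with hq
  have hlb := logDerivBeta_pos hp hm0
  have hμ' : (0 : ℝ) < μ := by exact_mod_cast hμ
  have hq0 : 0 < q := by positivity
  set M := ∑' n, ‖b n‖ with hM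
  have hPM : ∀ t, 0 ≤ t → |(powSum b (diskPoint μ p (θ t) (J t))).im| ≤ M := fun t ht =>
    (Complex.abs_im_le_norm _).trans (norm_powSum_le_tsum (summable_norm_of_eulerCoeff hb b0)
      (norm_diskPoint_lt_one hμ hp (h.pos t ht) _).le)
  have hM0 : 0 ≤ M := tsum_nonneg fun _ => norm_nonneg _
  -- By this time -Im P has grown by at least qT = 2M + 1, more than the 2M that |P| ≤ M permits.
  set T := (2 * M + 1) / q with hT
  have hT0 : 0 ≤ T := by positivity
  have key := mul_sub_le_of_hasDerivWithinAt_Ici (m := q)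
    (fun t ht => h.hasDerivWithinAt_im_powSum hC hμ hp ht) le_rfl hT0 (fun t ht => by
      have h1 : δ ≤ ‖powSum (eulerCoeff b) (diskPoint μ p (θ t) (J t))‖ := hmin (hmem t ht.1)
      have h2 := logDerivBeta_antitone hp (h.pos t ht.1) (hm t ht.1)
      have h3 := logDerivBeta_pos hp (h.pos t ht.1)
      rw [hq]
      gcongr)
  have hqT : q * (T - 0) = 2 * M + 1 := by rw [hT]; field_simp; ring
  have h1 := (abs_le.1 (hPM T hT0)).1
  have h2 := (abs_le.1 (hPM 0 le_rfl)).2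
  linarith

omit hκ in
/-- Near the boundary, the action is strictly monotone on the level set. -/
theorem exists_boundary_layer : ∃ δ > 0, ∃ m > 0, ∀ t, 0 ≤ t → m ≤ J t →
    δ ≤ |(powSum (eulerCoeff b) (diskPoint μ p (θ t) (J t))).im| := by
  have hC := norm_le_tsum_eulerCoeff hb b0
  set c := (powSum b (diskPoint μ p (θ 0) (J 0))).re with hcdef
  have hcontP := continuousOn_powSum_closedBall (summable_norm_of_eulerCoeff hb b0)
  have hcontD := continuousOn_powSum_closedBall hb
  set E : Set ℂ := Metric.closedBall 0 1 ∩ (fun z => (powSum b z).re) ⁻¹' {c} with hE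
  have hEc : IsCompact E := (isCompact_closedBall 0 1).of_isClosed_subset
    ((Complex.continuous_re.comp_continuousOn hcontP).preimage_isClosed_of_isClosed
      Metric.isClosed_closedBall isClosed_singleton) Set.inter_subset_left
  have hmem : ∀ t, 0 ≤ t → diskPoint μ p (θ t) (J t) ∈ E := fun t ht =>
    ⟨mem_closedBall_zero_iff.2 (norm_diskPoint_lt_one hμ hp (h.pos t ht) _).le,
      h.re_powSum_eq hC hμ hp ht⟩
  -- On the closed disk this sum vanishes only where |z| = 1 and Im D = 0, which a noncritical level
  -- excludes; its minimum on the level is therefore positive.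
  have hcont : ContinuousOn (fun z => |(powSum (eulerCoeff b) z).im| + (1 - ‖z‖)) E :=
    ((Complex.continuous_im.comp_continuousOn (hcontD.mono Set.inter_subset_left)).abs).add
      (by fun_prop)
  obtain ⟨z₀, hz₀, hmin⟩ := hEc.exists_isMinOn ⟨_, hmem 0 le_rfl⟩ hcont
  have hz₀1 := mem_closedBall_zero_iff.1 hz₀.1
  set d := |(powSum (eulerCoeff b) z₀).im| + (1 - ‖z₀‖) with hd
  have hd0 : 0 < d := by
    rcases hz₀1.lt_or_eq with hlt | heq
    · have := abs_nonneg (powSum (eulerCoeff b) z₀).im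
      linarith
    · have : (powSum (eulerCoeff b) z₀).im ≠ 0 := fun h0 => hc ⟨z₀, hz₀.2, Or.inr ⟨heq, h0⟩⟩
      have := abs_pos.2 this
      linarith
  have hlim : Tendsto (fun y => beta p y ^ μ) atTop (𝓝 1) := by
    simpa using (tendsto_beta_atTop hp).pow μ
  -- Once 1 - |z| < d/2, the other summand must be at least d/2.
  obtain ⟨m, hm⟩ := eventually_atTop.1
    (hlim.eventually (lt_mem_nhds (by linarith : 1 - d / 2 < 1)))
  refine ⟨d / 2, by positivity, max m 1, lt_of_lt_of_le one_pos (le_max_right _ _),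
    fun t ht hJ => ?_⟩
  have h1 : d ≤ _ := hmin (hmem t ht)
  have h2 := hm (J t) ((le_max_left _ _).trans hJ)
  simp only [norm_diskPoint] at h1
  linarith

/-- In the boundary layer v = -Im D satisfies |v| ≥ δ, so by continuity its sign cannot change
there. It must be positive at some time in the layer, since J is unbounded; from then on J increases
and never leaves the layer. -/
theorem exists_eventually_action_rate : ∃ δ > 0, ∃ t₀, 0 ≤ t₀ ∧ ∀ t, t₀ ≤ t →
    δ ≤ -(powSum (eulerCoeff b) (diskPoint μ p (θ t) (J t))).im := by
  have hC := norm_le_tsum_eulerCoeff hb b0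
  obtain ⟨δ, hδ, m, hm0, hm⟩ := h.exists_boundary_layer hb b0 hp hμ hc
  set v : ℝ → ℝ := fun t => -(powSum (eulerCoeff b) (diskPoint μ p (θ t) (J t))).im with hv
  have hJd : ∀ t, 0 ≤ t → HasDerivWithinAt J (κ * v t) (Set.Ici 0) t := fun t ht =>
    (h.action t ht).congr_deriv (by simp [hv])
  have habs : ∀ t, 0 ≤ t → m ≤ J t → δ ≤ |v t| := fun t ht hJ => by
    rw [hv, abs_neg]; exact hm t ht hJ
  have hvc : ContinuousOn v (Set.Ici 0) := by
    intro t ht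
    have h1 := (hasDerivWithinAt_diskPoint μ hp (h.angle t ht) (h.action t ht)
      (h.pos t ht)).continuousWithinAt
    have h2 := ((differentiableOn_powSum_eulerCoeff hC).differentiableAt
      (Metric.isOpen_ball.mem_nhds (mem_ball_zero_iff.2
        (norm_diskPoint_lt_one hμ hp (h.pos t ht) (θ t))))).continuousAt
    exact (Complex.continuous_im.continuousAt.comp_continuousWithinAt
      (ContinuousAt.comp_continuousWithinAt
      (f := fun t => diskPoint μ p (θ t) (J t)) h2 h1)).neg
  obtain ⟨t₀, ht₀, hJ₀, hv₀⟩ : ∃ t₀, 0 ≤ t₀ ∧ m ≤ J t₀ ∧ 0 < v t₀ := by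
    by_contra! hneg
    obtain ⟨t₁, ht₁, hJ₁⟩ := h.not_bounded hb b0 hκ hp hμ hc (max m (J 0))
    -- If v ≤ 0 throughout the layer, then J' < 0 whenever J reaches max(m, J(0)), so J can never
    -- cross this barrier.
    refine absurd (image_le_of_deriv_right_lt_deriv_boundary (f := J) (f' := fun t => κ * v t)
      (a := 0) (b := t₁) (B := fun _ => max m (J 0)) (B' := fun _ => 0)
      (fun t ht => (hJd t ht.1).continuousWithinAt.mono fun s hs => hs.1)
      (fun t ht => (hJd t ht.1).mono (Set.Ici_subset_Ici.2 ht.1)) (le_max_right _ _)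
      (fun t => hasDerivAt_const t _) (fun t ht hJt => ?_) (Set.right_mem_Icc.2 ht₁)) (not_le.2 hJ₁)
    have hmJ : m ≤ J t := hJt ▸ le_max_left _ _
    have h1 := hneg t ht.1 hmJ
    have h2 := habs t ht.1 hmJ
    rw [abs_of_nonpos h1] at h2
    exact mul_neg_of_pos_of_neg hκ (by linarith)
  have hpos : ∀ t, t₀ ≤ t → 0 < v t := by
    by_contra! hneg
    obtain ⟨t₁, ht₁, hv₁⟩ := hneg
    -- The first time s with v ≤ 0: J has increased up to s, so s is still in the layer and v(s) ≤
    -- -δ.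
    set S : Set ℝ := Set.Icc t₀ t₁ ∩ v ⁻¹' Set.Iic 0 with hS
    have hSc : IsCompact S := isCompact_Icc.of_isClosed_subset
      ((hvc.mono fun s hs => ht₀.trans hs.1).preimage_isClosed_of_isClosed isClosed_Icc isClosed_Iic)
      Set.inter_subset_left
    obtain ⟨s, hs, hmin⟩ := hSc.exists_isLeast ⟨t₁, ⟨ht₁, le_rfl⟩, hv₁⟩
    have hs0 : t₀ ≤ s := hs.1.1
    have hvs : v s ≤ 0 := hs.2
    have hlt : ∀ t, t₀ ≤ t → t < s → 0 < v t := fun t h1 h2 => by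
      by_contra! h3
      exact absurd (hmin ⟨⟨h1, h2.le.trans hs.1.2⟩, h3⟩) (not_le.2 h2)
    have hle : J t₀ ≤ J s := by
      have hmono : MonotoneOn J (Set.Icc t₀ s) := by
        refine monotoneOn_of_deriv_nonneg (convex_Icc _ _)
          (fun t ht => (hJd t (ht₀.trans ht.1)).continuousWithinAt.mono fun s hs => ht₀.trans hs.1)
          (fun t ht => ?_) (fun t ht => ?_)
        all_goals
          rw [interior_Icc] at ht
          have hda := (hJd t (ht₀.trans ht.1.le)).hasDerivAt (Ici_mem_nhds (ht₀.trans_lt ht.1))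
        · exact hda.differentiableAt.differentiableWithinAt
        · rw [hda.deriv]
          exact (mul_pos hκ (hlt t ht.1.le ht.2)).le
      exact hmono (Set.left_mem_Icc.2 hs0) (Set.right_mem_Icc.2 hs0) hs0
    have hvs' := habs s (ht₀.trans hs0) (hJ₀.trans hle)
    rw [abs_of_nonpos hvs] at hvs'
    -- The value -δ/2 would be taken on [t₀, s], but v > 0 before s and v(s) ≤ -δ.
    obtain ⟨t, ht, hvt⟩ := intermediate_value_Icc' hs0
      (hvc.mono fun s hs => ht₀.trans hs.1) (⟨by linarith, by linarith⟩ :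
        -(δ / 2) ∈ Set.Icc (v s) (v t₀))
    rcases ht.2.lt_or_eq with h1 | h1
    · have := hlt t ht.1 h1
      linarith
    · rw [h1] at hvt
      linarith
  refine ⟨δ, hδ, t₀, ht₀, fun t ht => ?_⟩
  have hJt : J t₀ ≤ J t := by
    have := mul_sub_le_of_hasDerivWithinAt_Ici hJd ht₀ ht (m := 0)
      fun s hs => (mul_pos hκ (hpos s hs.1)).le
    linarith
  have := habs t (ht₀.trans ht) (hJ₀.trans hJt)
  rwa [abs_of_pos (hpos t ht)] at this

theorem exists_tendsto : ∃ θinf C : ℝ, Tendsto J atTop atTop ∧ Tendsto θ atTop (𝓝 θinf) ∧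
    Tendsto (fun t => J t / t) atTop (𝓝 C) ∧ 0 < C ∧
    C = -κ * (powSum (eulerCoeff b)
      (Complex.I ^ μ * Complex.exp (Complex.I * θinf))).im := by
  obtain ⟨δ, hδ, t₀, ht₀, hrate⟩ := h.exists_eventually_action_rate hb b0 hκ hp hμ hc
  have hJtop : Tendsto J atTop atTop := by
    refine tendsto_atTop_mono' atTop (f₁ := fun t => J t₀ + κ * δ * (t - t₀)) ?_ ?_
    · filter_upwards [eventually_ge_atTop t₀] with t ht
      have := mul_sub_le_of_hasDerivWithinAt_Ici h.action ht₀ ht (m := κ * δ) fun s hs => by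
        rw [neg_mul_comm]
        exact mul_le_mul_of_nonneg_left (hrate s hs.1) hκ.le
      linarith
    · exact tendsto_atTop_add_const_left _ _ (Tendsto.const_mul_atTop (by positivity)
        (tendsto_atTop_add_const_right _ _ tendsto_id))
  set M := ∑' n, ‖eulerCoeff b n‖ with hM
  have hM0 : 0 ≤ M := tsum_nonneg fun _ => norm_nonneg _
  have hμ' : (0 : ℝ) < μ := by exact_mod_cast hμ
  have hDM : ∀ t, 0 ≤ t → ‖powSum (eulerCoeff b) (diskPoint μ p (θ t) (J t))‖ ≤ M := fun t ht =>
    norm_powSum_le_tsum hb (norm_diskPoint_lt_one hμ hp (h.pos t ht) _).le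
  set A := μ * M / δ with hA
  have hA0 : 0 ≤ A := by positivity
  -- |D| ≤ M and -Im D ≥ δ give |θ'| ≤ L', so θ + L increases and θ - L decreases; since L → 0, this
  -- forces θ to converge.
  set L : ℝ → ℝ := fun t => A * Real.log (beta p (J t)) with hL
  have hLd : ∀ t, 0 ≤ t → HasDerivWithinAt L (A * (logDerivBeta p (J t) * (-κ *
      (powSum (eulerCoeff b) (diskPoint μ p (θ t) (J t))).im))) (Set.Ici 0) t := fun t ht => by
    have h1 := (((hasDerivAt_beta hp (h.pos t ht)).comp_hasDerivWithinAt t (h.action t ht)).log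
      (beta_pos hp (h.pos t ht)).ne').const_mul A
    refine h1.congr_deriv ?_
    have := (beta_pos hp (h.pos t ht)).ne'
    simp only [Function.comp]
    field_simp
  have hbound : ∀ t, t₀ ≤ t → |(-κ * (μ * logDerivBeta p (J t)) *
      (powSum (eulerCoeff b) (diskPoint μ p (θ t) (J t))).re)| ≤ A * (logDerivBeta p (J t) * (-κ *
      (powSum (eulerCoeff b) (diskPoint μ p (θ t) (J t))).im)) := fun t ht => by
    have hlb := logDerivBeta_pos hp (h.pos t (ht₀.trans ht))
    rw [abs_mul, abs_mul, abs_neg, abs_of_pos hκ, abs_of_pos (by positivity)]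
    calc _ ≤ κ * (μ * logDerivBeta p (J t)) * M := by
          gcongr
          exact (Complex.abs_re_le_norm _).trans (hDM t (ht₀.trans ht))
      _ = A * (logDerivBeta p (J t) * (κ * δ)) := by rw [hA]; field_simp
      _ ≤ _ := by
          rw [neg_mul_comm]
          gcongr
          exact hrate t ht
  have hplus : ∀ s t, t₀ ≤ s → s ≤ t → θ s + L s ≤ θ t + L t := fun s t hs hst => by
    have := mul_sub_le_of_hasDerivWithinAt_Ici (m := 0)
      (fun t ht => (h.angle t ht).add (hLd t ht)) (ht₀.trans hs) hst fun x hx => by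
        have := (abs_le.1 (hbound x (hs.trans hx.1))).1
        linarith
    simp only [Pi.add_apply] at this
    linarith
  have hminus : ∀ s t, t₀ ≤ s → s ≤ t → θ t - L t ≤ θ s - L s := fun s t hs hst => by
    have := mul_sub_le_of_hasDerivWithinAt_Ici (m := 0)
      (fun t ht => (hLd t ht).sub (h.angle t ht)) (ht₀.trans hs) hst fun x hx => by
        have := (abs_le.1 (hbound x (hs.trans hx.1))).2
        linarith
    simp only [Pi.sub_apply] at this
    linarith
  have hL0 : ∀ t, t₀ ≤ t → L t ≤ 0 := fun t ht =>
    mul_nonpos_of_nonneg_of_nonpos hA0 (Real.log_nonpos (beta_nonneg _ _)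
      (beta_lt_one hp (h.pos t (ht₀.trans ht))).le)
  have hLlim : Tendsto L atTop (𝓝 0) := by
    have := (((tendsto_beta_atTop hp).comp hJtop).log one_ne_zero).const_mul A
    simpa using this
  obtain ⟨θinf, hθ⟩ : ∃ θinf, Tendsto θ atTop (𝓝 θinf) := by
    -- Freezing the function before t₀ makes it monotone on the whole line.
    have hmono : Monotone fun t => θ (max t t₀) + L (max t t₀) := fun s t hst =>
      hplus _ _ (le_max_right _ _) (max_le_max_right _ hst)
    have hbdd : BddAbove (Set.range fun t => θ (max t t₀) + L (max t t₀)) := by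
      refine ⟨θ t₀ - L t₀, ?_⟩
      rintro _ ⟨t, rfl⟩
      have h1 := hminus t₀ (max t t₀) le_rfl (le_max_right _ _)
      have h2 := hL0 (max t t₀) (le_max_right _ _)
      simp only
      linarith
    have h1 := tendsto_atTop_ciSup hmono hbdd
    have h2 : Tendsto (fun t => θ t + L t) atTop (𝓝 (⨆ t, θ (max t t₀) + L (max t t₀))) := by
      refine h1.congr' ?_
      filter_upwards [eventually_ge_atTop t₀] with t ht
      rw [max_eq_left ht]
    refine ⟨_, (h2.sub hLlim).congr fun t => ?_⟩
    ring
  have hz : Tendsto (fun t => diskPoint μ p (θ t) (J t)) atTop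
      (𝓝 (Complex.I ^ μ * Complex.exp (Complex.I * θinf))) := by
    have h1 : Tendsto (fun t => ((beta p (J t) : ℝ) : ℂ)) atTop (𝓝 1) := by
      have := (Complex.continuous_ofReal.tendsto _).comp ((tendsto_beta_atTop hp).comp hJtop)
      rwa [Complex.ofReal_one] at this
    have h2 : Tendsto (fun t => Complex.exp (Complex.I * (θ t : ℝ))) atTop
        (𝓝 (Complex.exp (Complex.I * θinf))) :=
      ((Complex.continuous_exp.comp (continuous_const.mul Complex.continuous_ofReal)).tendsto
        θinf).comp hθ
    simpa [diskPoint] using ((h1.pow μ).const_mul (Complex.I ^ μ)).mul h2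
  have hw : ‖Complex.I ^ μ * Complex.exp (Complex.I * θinf)‖ = 1 := by
    rw [norm_mul, norm_exp_I_mul_ofReal]; simp
  have hD : Tendsto (fun t => powSum (eulerCoeff b) (diskPoint μ p (θ t) (J t))) atTop
      (𝓝 (powSum (eulerCoeff b) (Complex.I ^ μ * Complex.exp (Complex.I * θinf)))) := by
    refine (continuousOn_powSum_closedBall hb _ (mem_closedBall_zero_iff.2 hw.le)).tendsto.comp
      (tendsto_nhdsWithin_iff.2 ⟨hz, ?_⟩)
    filter_upwards [eventually_ge_atTop 0] with t ht
    exact mem_closedBall_zero_iff.2 (norm_diskPoint_lt_one hμ hp (h.pos t ht) _).le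
  have hDim := (Complex.continuous_im.tendsto _).comp hD
  have hJ' := hDim.const_mul (-κ)
  refine ⟨θinf, _, hJtop, hθ, tendsto_div_of_tendsto_deriv
    (fun t ht => (h.action t ht.le).hasDerivAt (Ici_mem_nhds ht)) hJ', ?_, rfl⟩
  have hge : δ ≤ -(powSum (eulerCoeff b) (Complex.I ^ μ * Complex.exp (Complex.I * θinf))).im := by
    refine ge_of_tendsto hDim.neg ?_
    filter_upwards [eventually_ge_atTop t₀] with t ht
    exact hrate t ht
  rw [neg_mul_comm]
  exact mul_pos hκ (hδ.trans_le hge)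

end IsSlowSolution

/-! ### Global existence for the slow flow -/

/-- A bounded vector field of class `C¹` has an integral curve on `[0, ∞)` through each point. -/
theorem exists_integralCurve_of_bounded {E : Type*} [NormedAddCommGroup E] [NormedSpace ℝ E]
    [ProperSpace E] {v : E → E} (hv : ContDiff ℝ 1 v) {L : ℝ} (hL : ∀ x, ‖v x‖ ≤ L) (x₀ : E) :
    ∃ γ : ℝ → E, γ 0 = x₀ ∧ ∀ t, 0 ≤ t → HasDerivWithinAt γ (v (γ t)) (Set.Ici 0) t := by
  have hL0 : 0 ≤ L := (norm_nonneg _).trans (hL x₀)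
  have hloc : ∀ T : ℝ, ∃ γ : ℝ → E, 0 ≤ T → γ 0 = x₀ ∧
      ∀ t ∈ Set.Icc 0 T, HasDerivWithinAt γ (v (γ t)) (Set.Icc 0 T) t := by
    intro T
    by_cases hT : 0 ≤ T
    · obtain ⟨K, hK⟩ := (hv.locallyLipschitz.locallyLipschitzOn
        (s := Metric.closedBall x₀ (L * T))).exists_lipschitzOnWith_of_compact
        (isCompact_closedBall _ _)
      -- A curve of speed at most L stays in the ball of radius LT up to time T, so the
      -- Picard–Lindelöf interval can be all of [0, T].
      have hpl := IsPicardLindelof.of_time_independent (f := v) (tmin := 0) (tmax := T)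
        (t₀ := ⟨0, le_rfl, hT⟩) (x₀ := x₀) (a := ⟨L * T, by positivity⟩) (r := 0)
        (L := ⟨L, hL0⟩) (K := K) (fun x _ => hL x) hK (by
          simp only [sub_zero, sub_self, max_eq_left hT, NNReal.coe_zero]
          exact le_rfl)
      obtain ⟨γ, h0, hγ⟩ := hpl.exists_eq_forall_mem_Icc_hasDerivWithinAt₀
      exact ⟨γ, fun _ => ⟨h0, hγ⟩⟩
    · exact ⟨fun _ => x₀, fun h => absurd h hT⟩
  choose γ hγ using hloc
  have huniq : ∀ s T T', 0 ≤ s → s ≤ T → s ≤ T' → γ T s = γ T' s := by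
    intro s T T' hs hT hT'
    have hc : ∀ T, s ≤ T → ContinuousOn (γ T) (Set.Icc 0 s) := fun T hT t ht =>
      (((hγ T (hs.trans hT)).2 t ⟨ht.1, ht.2.trans hT⟩).continuousWithinAt).mono
        (Set.Icc_subset_Icc_right hT)
    have hd : ∀ T, s ≤ T → ∀ t ∈ Set.Ico 0 s,
        HasDerivWithinAt (γ T) (v (γ T t)) (Set.Ici t) t := fun T hT t ht =>
      ((hγ T (hs.trans hT)).2 t ⟨ht.1, ht.2.le.trans hT⟩).mono_of_mem_nhdsWithin
        (mem_of_superset (Icc_mem_nhdsGE (ht.2.trans_le hT))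
          (Set.Icc_subset_Icc_left ht.1))
    -- Both curves have compact image, and the field is Lipschitz on the union of the two images.
    obtain ⟨K, hK⟩ := (hv.locallyLipschitz.locallyLipschitzOn
      (s := γ T '' Set.Icc 0 s ∪ γ T' '' Set.Icc 0 s)).exists_lipschitzOnWith_of_compact
      ((isCompact_Icc.image_of_continuousOn (hc T hT)).union
        (isCompact_Icc.image_of_continuousOn (hc T' hT')))
    exact ODE_solution_unique_of_mem_Icc_right (v := fun _ => v)
      (s := fun _ => γ T '' Set.Icc 0 s ∪ γ T' '' Set.Icc 0 s) (fun _ _ => hK)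
      (hc T hT) (hd T hT) (fun t ht => Or.inl ⟨t, ⟨ht.1, ht.2.le⟩, rfl⟩)
      (hc T' hT') (hd T' hT') (fun t ht => Or.inr ⟨t, ⟨ht.1, ht.2.le⟩, rfl⟩)
      ((hγ T (hs.trans hT)).1.trans (hγ T' (hs.trans hT')).1.symm) ⟨hs, le_rfl⟩
  -- The value at t is read off the solution on [0, t + 1], so that the interval is a neighbourhood
  -- of t within [0, ∞).
  refine ⟨fun t => γ (t + 1) t, (hγ _ (by norm_num)).1, fun t ht => ?_⟩
  have h1 := (hγ (t + 1) (by linarith)).2 t ⟨ht, by linarith⟩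
  have hmem : Set.Icc 0 (t + 1) ∈ 𝓝[Set.Ici 0] t := by
    rw [← Set.Ici_inter_Iic]
    exact inter_mem_nhdsWithin _ (Iic_mem_nhds (by linarith))
  refine HasDerivWithinAt.mono_of_mem_nhdsWithin (t := Set.Icc 0 (t + 1))
    (h1.congr (fun s hs => ?_) rfl) hmem
  exact huniq s (s + 1) (t + 1) hs.1 (by linarith) hs.2

theorem contDiff_beta_exp {p : ℝ} (hp : 0 < p) : ContDiff ℝ 1 fun s : ℝ => beta p (Real.exp s) := by
  have h : ∀ s : ℝ, Real.exp s + p ≠ 0 := fun s => by positivity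
  unfold beta
  exact (Real.contDiff_exp.div (Real.contDiff_exp.add contDiff_const) h).sqrt
    fun s => (div_pos (Real.exp_pos s) (add_pos (Real.exp_pos s) hp)).ne'

/-- The slow vector field in the coordinates `(θ, log J)`. -/
def slowField (b : ℕ → ℂ) (κ p : ℝ) (μ : ℕ) (x : ℝ × ℝ) : ℝ × ℝ :=
  (-κ * (μ * logDerivBeta p (Real.exp x.2)) *
    (powSum (eulerCoeff b) (diskPoint μ p x.1 (Real.exp x.2))).re,
   Real.exp (-x.2) * (-κ * (powSum (eulerCoeff b) (diskPoint μ p x.1 (Real.exp x.2))).im))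

theorem contDiff_slowField {b : ℕ → ℂ} {C : ℝ} (hC : ∀ n, ‖b n‖ ≤ C) (κ : ℝ) {p : ℝ} (hp : 0 < p)
    {μ : ℕ} (hμ : 0 < μ) : ContDiff ℝ 1 (slowField b κ p μ) := by
  have hz : ContDiff ℝ 1 fun x : ℝ × ℝ => diskPoint μ p x.1 (Real.exp x.2) := by
    unfold diskPoint
    have h1 : ContDiff ℝ 1 fun x : ℝ × ℝ => ((beta p (Real.exp x.2) : ℝ) : ℂ) :=
      Complex.ofRealCLM.contDiff.comp ((contDiff_beta_exp hp).comp contDiff_snd)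
    have h2 : ContDiff ℝ 1 fun x : ℝ × ℝ => Complex.exp (Complex.I * (x.1 : ℝ)) :=
      (contDiff_const.mul (Complex.ofRealCLM.contDiff.comp contDiff_fst)).cexp
    exact (contDiff_const.mul (h1.pow μ)).mul h2
  have hD : ContDiff ℝ 1 fun x : ℝ × ℝ =>
      powSum (eulerCoeff b) (diskPoint μ p x.1 (Real.exp x.2)) := by
    rw [contDiff_iff_contDiffAt]
    intro x
    have h := (((differentiableOn_powSum_eulerCoeff hC).analyticAt
      (Metric.isOpen_ball.mem_nhds (mem_ball_zero_iff.2
        (norm_diskPoint_lt_one hμ hp (Real.exp_pos x.2) x.1)))).contDiffAt (n := 1)).restrict_scalars ℝ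
    exact ContDiffAt.comp (f := fun x : ℝ × ℝ => diskPoint μ p x.1 (Real.exp x.2)) x h hz.contDiffAt
  have hexp : ContDiff ℝ 1 fun x : ℝ × ℝ => Real.exp x.2 := contDiff_snd.exp
  have hlb : ContDiff ℝ 1 fun x : ℝ × ℝ => logDerivBeta p (Real.exp x.2) :=
    contDiff_const.div ((contDiff_const.mul hexp).mul (hexp.add contDiff_const))
      fun x => by positivity
  exact ((contDiff_const.mul (contDiff_const.mul hlb)).mul
    (Complex.reCLM.contDiff.comp hD)).prodMk
    ((contDiff_snd.neg.exp).mul (contDiff_const.mul (Complex.imCLM.contDiff.comp hD)))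

section

variable {b : ℕ → ℂ} (hb : Summable fun n => ‖eulerCoeff b n‖) (b0 : b 0 = 0)
include hb b0

-- The cutoff vanishes for log J ≤ a - 1. Above that, both β'/β and 1/J are decreasing in J, so
-- their values at e^{a-1} bound the field.
omit b0 in
theorem exists_cutoff_slowField_le {κ : ℝ} (hκ : 0 < κ) {p : ℝ} (hp : 0 < p)
    {μ : ℕ} (hμ : 0 < μ) (a : ℝ) :
    ∃ L, ∀ x : ℝ × ℝ, ‖Real.smoothTransition (x.2 - a + 1) • slowField b κ p μ x‖ ≤ L := by
  set M := ∑' n, ‖eulerCoeff b n‖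
  have hM0 : 0 ≤ M := tsum_nonneg fun _ => norm_nonneg _
  have hlb := logDerivBeta_pos hp (Real.exp_pos (a - 1))
  set L := κ * (μ * logDerivBeta p (Real.exp (a - 1))) * M + Real.exp (-(a - 1)) * (κ * M) with hL
  have hL0 : 0 ≤ L := by positivity
  refine ⟨L, fun x => ?_⟩
  by_cases hx : x.2 ≤ a - 1
  · rw [Real.smoothTransition.zero_of_nonpos (by linarith), zero_smul, norm_zero]
    exact hL0
  · push Not at hx
    have hD := norm_powSum_le_tsum hb
      (norm_diskPoint_lt_one hμ hp (Real.exp_pos x.2) x.1).le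
    have hre := (Complex.abs_re_le_norm _).trans hD
    have him := (Complex.abs_im_le_norm _).trans hD
    have hlx := logDerivBeta_pos hp (Real.exp_pos x.2)
    have hle := logDerivBeta_antitone hp (Real.exp_pos (a - 1)) (Real.exp_le_exp.2 hx.le)
    have h1 : ‖(slowField b κ p μ x).1‖ ≤ κ * (μ * logDerivBeta p (Real.exp (a - 1))) * M := by
      rw [slowField, Real.norm_eq_abs, abs_mul, abs_mul, abs_neg, abs_of_pos hκ,
        abs_of_nonneg (by positivity)]
      gcongr
    have h2 : ‖(slowField b κ p μ x).2‖ ≤ Real.exp (-(a - 1)) * (κ * M) := by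
      rw [slowField, Real.norm_eq_abs, abs_mul, abs_mul, abs_neg, abs_of_pos hκ, Real.abs_exp]
      gcongr
    have h3 : ‖slowField b κ p μ x‖ ≤ L := by
      rw [Prod.norm_def]
      refine max_le (h1.trans ?_) (h2.trans ?_)
      · exact le_add_of_nonneg_right (by positivity)
      · exact le_add_of_nonneg_left (by positivity)
    rw [norm_smul, Real.norm_of_nonneg (Real.smoothTransition.nonneg _)]
    exact (mul_le_of_le_one_left (norm_nonneg _) (Real.smoothTransition.le_one _)).trans h3

/-- On a nonzero level of `Re P` the action is bounded below. -/
theorem exists_action_lower_bound {c : ℝ} (hc : c ≠ 0) {p : ℝ} (hp : 0 < p) {μ : ℕ} (hμ : 0 < μ) :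
    ∃ m > 0, ∀ θ J : ℝ, 0 < J → (powSum b (diskPoint μ p θ J)).re = c → m ≤ J := by
  have hP0 : powSum b 0 = 0 := by
    rw [powSum, tsum_eq_single 0 fun n hn => by simp [hn]]
    simp [b0]
  have hcont : ContinuousAt (fun z => (powSum b z).re) 0 :=
    Complex.continuous_re.continuousAt.comp
      ((differentiableOn_powSum (norm_le_tsum_eulerCoeff hb b0)).differentiableAt
        (Metric.isOpen_ball.mem_nhds (Metric.mem_ball_self one_pos))).continuousAt
  have hev : ∀ᶠ z in 𝓝 (0 : ℂ), (powSum b z).re ≠ c :=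
    hcont.eventually_ne (by simpa [hP0] using hc.symm)
  obtain ⟨r, hr, hball⟩ := Metric.eventually_nhds_iff_ball.1 hev
  refine ⟨p * r ^ 2, by positivity, fun θ J hJ hlev => ?_⟩
  have h1 : r ≤ beta p J ^ μ := by
    by_contra! hlt
    refine hball _ ?_ hlev
    rwa [mem_ball_zero_iff, norm_diskPoint]
  have h2 : beta p J ^ μ ≤ beta p J :=
    pow_le_of_le_one (beta_nonneg p J) (beta_lt_one hp hJ).le hμ.ne'
  have h3 := (h1.trans h2).trans (beta_le_sqrt hp hJ)
  rw [Real.le_sqrt' hr, le_div_iff₀ hp] at h3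
  linarith

/-- In the coordinates (θ, log J) the cut-off field is bounded, so its flow is global. The cutoff
only rescales speed and thus preserves Re P; on a nonzero level J is bounded below, so the cutoff
equals 1 along the whole curve. -/
theorem exists_isSlowSolution {κ : ℝ} (hκ : 0 < κ) {p : ℝ} (hp : 0 < p)
    {μ : ℕ} (hμ : 0 < μ) (θ₀ : ℝ) {J₀ : ℝ} (hJ₀ : 0 < J₀)
    (hc : (powSum b (diskPoint μ p θ₀ J₀)).re ≠ 0) :
    ∃ θ J : ℝ → ℝ, IsSlowSolution b κ p μ θ J ∧ θ 0 = θ₀ ∧ J 0 = J₀ := by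
  have hC := norm_le_tsum_eulerCoeff hb b0
  obtain ⟨m, hm0, hm⟩ := exists_action_lower_bound hb b0 hc hp hμ
  obtain ⟨L, hL⟩ := exists_cutoff_slowField_le hb hκ hp hμ (Real.log m)
  have hsm : ContDiff ℝ 1 fun x : ℝ × ℝ =>
      Real.smoothTransition (x.2 - Real.log m + 1) • slowField b κ p μ x :=
    (Real.smoothTransition.contDiff.comp ((contDiff_snd.sub contDiff_const).add
      contDiff_const)).smul (contDiff_slowField hC κ hp hμ)
  obtain ⟨γ, hγ0, hγ⟩ := exists_integralCurve_of_bounded hsm hL (θ₀, Real.log J₀)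
  set χ : ℝ → ℝ := fun t => Real.smoothTransition ((γ t).2 - Real.log m + 1) with hχ
  set θ : ℝ → ℝ := fun t => (γ t).1 with hθ
  set J : ℝ → ℝ := fun t => Real.exp (γ t).2 with hJ
  have hJpos : ∀ t, 0 < J t := fun t => Real.exp_pos _
  have hθd : ∀ t, 0 ≤ t → HasDerivWithinAt θ (χ t * (-κ * (μ * logDerivBeta p (J t)) *
      (powSum (eulerCoeff b) (diskPoint μ p (θ t) (J t))).re)) (Set.Ici 0) t := fun t ht =>
    (hasFDerivAt_fst (𝕜 := ℝ) (p := γ t)).comp_hasDerivWithinAt t (hγ t ht)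
  have hsd : ∀ t, 0 ≤ t → HasDerivWithinAt (fun t => (γ t).2) (χ t * (Real.exp (-(γ t).2) *
      (-κ * (powSum (eulerCoeff b) (diskPoint μ p (θ t) (J t))).im))) (Set.Ici 0) t := fun t ht =>
    (hasFDerivAt_snd (𝕜 := ℝ) (p := γ t)).comp_hasDerivWithinAt t (hγ t ht)
  have hJd : ∀ t, 0 ≤ t → HasDerivWithinAt J (χ t * (-κ *
      (powSum (eulerCoeff b) (diskPoint μ p (θ t) (J t))).im)) (Set.Ici 0) t := fun t ht => by
    refine (hsd t ht).exp.congr_deriv ?_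
    rw [Real.exp_neg]
    have := (Real.exp_pos (γ t).2).ne'
    field_simp
  have hd : ∀ t, 0 ≤ t → HasDerivWithinAt (fun t => (powSum b (diskPoint μ p (θ t) (J t))).re)
      0 (Set.Ici 0) t := fun t ht =>
    (Complex.reCLM.hasFDerivAt.comp_hasDerivWithinAt t
      (hasDerivWithinAt_powSum_of_slow hC hμ hp (hJpos t) (hθd t ht) (hJd t ht))).congr_deriv (by
        simp [-Complex.ofReal_neg, -Complex.ofReal_mul])
  have h0 : (powSum b (diskPoint μ p (θ 0) (J 0))).re = (powSum b (diskPoint μ p θ₀ J₀)).re := by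
    simp only [hθ, hJ, hγ0, Real.exp_log hJ₀]
  have hlev : ∀ t, 0 ≤ t → (powSum b (diskPoint μ p (θ t) (J t))).re =
      (powSum b (diskPoint μ p θ₀ J₀)).re := fun t ht => by
    have h1 := mul_sub_le_of_hasDerivWithinAt_Ici hd le_rfl ht (m := 0) fun _ _ => le_rfl
    have h2 := mul_sub_le_of_hasDerivWithinAt_Ici (fun t ht => (hd t ht).neg.congr_deriv neg_zero)
      le_rfl ht (m := 0) fun _ _ => le_rfl
    simp only [Pi.neg_apply] at h2
    linarith
  have hχ1 : ∀ t, 0 ≤ t → χ t = 1 := fun t ht => by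
    have h1 := hm (θ t) (J t) (hJpos t) (hlev t ht)
    have h2 : Real.log m ≤ (γ t).2 := (Real.log_le_iff_le_exp hm0).2 h1
    exact Real.smoothTransition.one_of_one_le (by linarith)
  refine ⟨θ, J, ⟨fun t _ => hJpos t, fun t ht => ?_, fun t ht => ?_⟩, ?_, ?_⟩
  · simpa only [hχ1 t ht, one_mul] using hθd t ht
  · simpa only [hχ1 t ht, one_mul] using hJd t ht
  · simp only [hθ, hγ0]
  · simp only [hJ, hγ0, Real.exp_log hJ₀]

end

/-! ### Hamilton's equations and the slow system -/

section Hamiltonian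

variable {f : C(Circ, ℝ)} {μ ν : ℕ} (hμ : 0 < μ) (hν : 0 < ν)
  (hf : Summable fun k : ℕ => (k : ℝ) * ‖coeff f (k : ℤ)‖) {p J : ℝ} (hp : 0 < p)
include hμ hν hf hp

theorem hasDerivAt_re_powSum_resCoeff_angle (hJ : 0 < J) (θ : ℝ) :
    HasDerivAt (fun x => (powSum (resCoeff f ν) (diskPoint μ p x J)).re)
      (-(powSum (eulerCoeff (resCoeff f ν)) (diskPoint μ p θ J)).im) θ := by
  obtain ⟨C, hC⟩ := exists_norm_coeff_le hν hf
  refine (Complex.reCLM.hasFDerivAt.comp_hasDerivAt θ (hasDerivAt_powSum_comp hC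
    (hasDerivAt_diskPoint_angle μ p θ J) (norm_diskPoint_lt_one hμ hp hJ θ))).congr_deriv ?_
  simp

theorem hasDerivAt_re_powSum_resCoeff_action (hJ : 0 < J) (θ : ℝ) :
    HasDerivAt (fun x => (powSum (resCoeff f ν) (diskPoint μ p θ x)).re)
      (μ * logDerivBeta p J *
        (powSum (eulerCoeff (resCoeff f ν)) (diskPoint μ p θ J)).re) J := by
  obtain ⟨C, hC⟩ := exists_norm_coeff_le hν hf
  refine (Complex.reCLM.hasFDerivAt.comp_hasDerivAt J (hasDerivAt_powSum_comp hC
    (hasDerivAt_diskPoint_action μ hp hJ θ) (norm_diskPoint_lt_one hμ hp hJ θ))).congr_deriv ?_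
  rw [Complex.reCLM_apply, mul_comm, Complex.re_ofReal_mul]

theorem deriv_avgHamiltonian_action_one (hJ : 0 < J) (ω₁ ε ψ₁ ψ₂ J₂ : ℝ) :
    deriv (fun y => avgHamiltonian f ω₁ ε p μ ν ψ₁ ψ₂ y J₂) J =
      ω₁ - ε * ω₁ * (μ * logDerivBeta p J * (powSum (eulerCoeff (resCoeff f ν))
        (diskPoint μ p (μ * ψ₁ - ν * ψ₂) J)).re) := by
  have hν' : (ν : ℝ) ≠ 0 := by exact_mod_cast hν.ne'
  have h1 := ((((hasDerivAt_id J).const_mul (ν : ℝ)).add_const (μ * J₂)).const_mul (ω₁ / ν)).add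
    (((hasDerivAt_re_powSum_resCoeff_action hμ hν hf hp hJ (μ * ψ₁ - ν * ψ₂)).const_mul
      (-ω₁)).const_mul ε)
  refine (h1.congr_of_eventuallyEq (f₁ := fun y => avgHamiltonian f ω₁ ε p μ ν ψ₁ ψ₂ y J₂)
    ?_).deriv.trans ?_
  · filter_upwards [lt_mem_nhds hJ] with y hy
    rw [avgHamiltonian, avgK₁_eq hμ hν hf ω₁ hp hy]
    rfl
  · field_simp
    ring

theorem deriv_avgHamiltonian_angle_one (hJ : 0 < J) (ω₁ ε ψ₁ ψ₂ J₂ : ℝ) :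
    deriv (fun x => avgHamiltonian f ω₁ ε p μ ν x ψ₂ J J₂) ψ₁ =
      ε * ω₁ * μ * (powSum (eulerCoeff (resCoeff f ν))
        (diskPoint μ p (μ * ψ₁ - ν * ψ₂) J)).im := by
  have h0 : HasDerivAt (fun x => (μ : ℝ) * x - ν * ψ₂) (μ * 1) ψ₁ :=
    ((hasDerivAt_id ψ₁).const_mul (μ : ℝ)).sub_const _
  have h1 := ((((hasDerivAt_re_powSum_resCoeff_angle hμ hν hf hp hJ (μ * ψ₁ - ν * ψ₂)).comp ψ₁
    h0).const_mul (-ω₁)).const_mul ε).const_add (ω₁ / ν * (ν * J + μ * J₂))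
  refine (h1.congr_of_eventuallyEq (f₁ := fun x => avgHamiltonian f ω₁ ε p μ ν x ψ₂ J J₂)
    (Eventually.of_forall fun y => ?_)).deriv.trans ?_
  · simp only [avgHamiltonian, avgK₁_eq hμ hν hf ω₁ hp hJ, Function.comp]
  · ring

theorem deriv_avgHamiltonian_angle_two (hJ : 0 < J) (ω₁ ε ψ₁ ψ₂ J₂ : ℝ) :
    deriv (fun x => avgHamiltonian f ω₁ ε p μ ν ψ₁ x J J₂) ψ₂ =
      -(ε * ω₁ * ν * (powSum (eulerCoeff (resCoeff f ν))
        (diskPoint μ p (μ * ψ₁ - ν * ψ₂) J)).im) := by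
  have h0 : HasDerivAt (fun x => (μ : ℝ) * ψ₁ - ν * x) (-(ν * 1)) ψ₂ :=
    ((hasDerivAt_id ψ₂).const_mul (ν : ℝ)).const_sub _
  have h1 := ((((hasDerivAt_re_powSum_resCoeff_angle hμ hν hf hp hJ (μ * ψ₁ - ν * ψ₂)).comp ψ₂
    h0).const_mul (-ω₁)).const_mul ε).const_add (ω₁ / ν * (ν * J + μ * J₂))
  refine (h1.congr_of_eventuallyEq (f₁ := fun x => avgHamiltonian f ω₁ ε p μ ν ψ₁ x J J₂)
    (Eventually.of_forall fun y => ?_)).deriv.trans ?_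
  · simp only [avgHamiltonian, avgK₁_eq hμ hν hf ω₁ hp hJ, Function.comp]
  · ring

omit hμ hν hf hp in
theorem deriv_avgHamiltonian_action_two (ω₁ ε ψ₁ ψ₂ J₂ : ℝ) :
    deriv (fun y => avgHamiltonian f ω₁ ε p μ ν ψ₁ ψ₂ J y) J₂ = ω₁ / ν * μ := by
  have h1 := ((((hasDerivAt_id J₂).const_mul (μ : ℝ)).const_add (ν * J)).const_mul
    (ω₁ / ν)).add_const (ε * avgK₁ f ω₁ p μ ν ψ₁ ψ₂ J)
  rw [mul_one] at h1
  exact h1.deriv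

/-- The fast frequencies ω₁ and ω₁μ/ν cancel in μψ₁ - νψ₂. -/
theorem IsAvgSolution.isSlowSolution {ω₁ ε : ℝ} {ψ₁ ψ₂ J₁ J₂ : ℝ → ℝ}
    (h : IsAvgSolution f ω₁ ε p μ ν ψ₁ ψ₂ J₁ J₂) :
    IsSlowSolution (resCoeff f ν) (ε * μ * ω₁) p μ (fun t => μ * ψ₁ t - ν * ψ₂ t) J₁ := by
  have hν' : (ν : ℝ) ≠ 0 := by exact_mod_cast hν.ne'
  refine ⟨h.pos, fun t ht => ?_, fun t ht => ?_⟩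
  · refine (((h.psi_one t ht).const_mul (μ : ℝ)).sub
      ((h.psi_two t ht).const_mul (ν : ℝ))).congr_deriv ?_
    rw [deriv_avgHamiltonian_action_one hμ hν hf hp (h.pos t ht), deriv_avgHamiltonian_action_two]
    field_simp
    ring
  · refine (h.act_one t ht).congr_deriv ?_
    rw [deriv_avgHamiltonian_angle_one hμ hν hf hp (h.pos t ht)]
    ring

omit hμ hν hf hp in
theorem IsAvgSolution.psi_two_eq {ω₁ ε : ℝ} {ψ₁ ψ₂ J₁ J₂ : ℝ → ℝ}
    (h : IsAvgSolution f ω₁ ε p μ ν ψ₁ ψ₂ J₁ J₂) {t : ℝ} (ht : 0 ≤ t) :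
    ψ₂ t = ψ₂ 0 + ω₁ / ν * μ * t := by
  have hd : ∀ t, 0 ≤ t → HasDerivWithinAt ψ₂ (ω₁ / ν * μ) (Set.Ici 0) t := fun t ht =>
    (h.psi_two t ht).congr_deriv (deriv_avgHamiltonian_action_two ..)
  have h1 := mul_sub_le_of_hasDerivWithinAt_Ici hd le_rfl ht fun _ _ => le_rfl
  have h2 := mul_sub_le_of_hasDerivWithinAt_Ici (fun t ht => (hd t ht).neg) le_rfl ht
    fun _ _ => le_rfl
  simp only [Pi.neg_apply] at h2
  linarith

/-- The angle ψ₂ rotates uniformly, ψ₁ is recovered from θ, and J₂ from the conservation of νJ₁ +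
μJ₂. -/
theorem IsSlowSolution.isAvgSolution {ω₁ ε : ℝ} {θ J₁ : ℝ → ℝ}
    (h : IsSlowSolution (resCoeff f ν) (ε * μ * ω₁) p μ θ J₁) (J₂₀ : ℝ) :
    IsAvgSolution f ω₁ ε p μ ν (fun t => (θ t + ν * (ω₁ / ν * μ * t)) / μ)
      (fun t => ω₁ / ν * μ * t) J₁ (fun t => J₂₀ - ν / μ * (J₁ t - J₁ 0)) := by
  have hν' : (ν : ℝ) ≠ 0 := by exact_mod_cast hν.ne'
  have hμ' : (μ : ℝ) ≠ 0 := by exact_mod_cast hμ.ne'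
  have e : ∀ t, (μ : ℝ) * ((θ t + ν * (ω₁ / ν * μ * t)) / μ) - ν * (ω₁ / ν * μ * t) = θ t :=
    fun t => by field_simp; ring
  have hlin : ∀ t, HasDerivWithinAt (fun t : ℝ => ω₁ / ν * μ * t) (ω₁ / ν * μ) (Set.Ici 0) t :=
    fun t => (((hasDerivAt_id t).const_mul (ω₁ / ν * μ)).congr_deriv (mul_one _)).hasDerivWithinAt
  refine ⟨h.pos, fun t ht => ?_, fun t ht => ?_, fun t ht => ?_, fun t ht => ?_⟩
  · rw [deriv_avgHamiltonian_action_one hμ hν hf hp (h.pos t ht), e]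
    refine (((h.angle t ht).add ((hlin t).const_mul (ν : ℝ))).div_const (μ : ℝ)).congr_deriv ?_
    field_simp
    ring
  · rw [deriv_avgHamiltonian_action_two]
    exact hlin t
  · rw [deriv_avgHamiltonian_angle_one hμ hν hf hp (h.pos t ht), e]
    refine (h.action t ht).congr_deriv ?_
    ring
  · rw [deriv_avgHamiltonian_angle_two hμ hν hf hp (h.pos t ht), e]
    refine ((((h.action t ht).sub_const (J₁ 0)).const_mul ((ν : ℝ) / μ)).const_sub
      J₂₀).congr_deriv ?_
    field_simp

end Hamiltonian

/-! ### The resonant average of f -/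

section average

variable {f : C(Circ, ℝ)} {ν : ℕ} (hν : 0 < ν)
  (hf : Summable fun k : ℕ => (k : ℝ) * ‖coeff f (k : ℤ)‖)
include hν hf

theorem average_zmultiples_eq (x : ℝ) :
    average f (AddSubgroup.zmultiples (ν : ℤ) : Set ℤ) x = coeff f 0 +
      ((2 * (powSum (resCoeff f ν) (Complex.exp (Complex.I * ((-ν * x : ℝ) : ℂ)))).re : ℝ) : ℂ) := by
  have hinj : Function.Injective fun m : ℤ => m * (ν : ℤ) := fun a c h =>
    mul_right_cancel₀ (by exact_mod_cast hν.ne') h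
  have hrange : (AddSubgroup.zmultiples (ν : ℤ) : Set ℤ) = Set.range fun m : ℤ => m * (ν : ℤ) := by
    ext k
    simp [AddSubgroup.mem_zmultiples_iff]
  set w := Complex.exp (Complex.I * ((-ν * x : ℝ) : ℂ)) with hw
  set g : ℤ → ℂ := fun m => coeff f (m * ν) *
    Complex.exp (Complex.I * ((m * (ν : ℤ) : ℤ) : ℂ) * (x : ℂ)) with hg
  have hreindex : average f (AddSubgroup.zmultiples (ν : ℤ) : Set ℤ) x = ∑' m : ℤ, g m := by
    rw [average, hrange]
    exact tsum_range (f := fun k : ℤ => coeff f k *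
      Complex.exp (Complex.I * (k : ℂ) * (x : ℂ))) hinj
  have hw1 : ‖w‖ = 1 := norm_exp_I_mul_ofReal _
  have hb := summable_norm_of_eulerCoeff (summable_eulerCoeff_resCoeff hν hf) (resCoeff_zero f ν)
  have hs : HasSum (fun n => resCoeff f ν n * w ^ n) (powSum (resCoeff f ν) w) := by
    refine (Summable.of_norm ?_).hasSum
    simpa [hw1] using hb
  have hsc : HasSum (fun n => (starRingEnd ℂ) (resCoeff f ν n * w ^ n))
      ((starRingEnd ℂ) (powSum (resCoeff f ν) w)) := Complex.hasSum_conj'.2 hs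
  -- `resCoeff` omits the mean, so it is restored at n = 0 in both halves; the double count is
  -- removed by `HasSum.of_nat_of_neg`.
  have hneg : ∀ n : ℕ, g (-(n : ℤ)) = resCoeff f ν n * w ^ n + if n = 0 then coeff f 0 else 0 := by
    intro n
    rcases n with _ | n
    · simp [hg, resCoeff]
    · have e : w ^ (n + 1) = Complex.exp (Complex.I *
          ((-((n + 1 : ℕ) : ℤ) * (ν : ℤ) : ℤ) : ℂ) * (x : ℂ)) := by
        rw [hw, ← Complex.exp_nat_mul]; push_cast; ring_nf
      simp only [hg, resCoeff, Nat.add_eq_zero_iff, one_ne_zero, and_false, if_false, add_zero, e,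
        neg_mul]
  have hpos : ∀ n : ℕ, g n = (starRingEnd ℂ) (resCoeff f ν n * w ^ n) +
      if n = 0 then coeff f 0 else 0 := by
    intro n
    rcases n with _ | n
    · simp [hg, resCoeff]
    · have e : (starRingEnd ℂ) (w ^ (n + 1)) = Complex.exp (Complex.I *
          ((((n + 1 : ℕ) : ℤ) * (ν : ℤ) : ℤ) : ℂ) * (x : ℂ)) := by
        rw [hw, ← Complex.exp_nat_mul, ← Complex.exp_conj]
        congr 1
        simp
        ring
      simp only [hg, resCoeff, Nat.add_eq_zero_iff, one_ne_zero, and_false, if_false, add_zero,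
        map_mul, e, ← coeff_neg, neg_neg]
  have hd : HasSum (fun n : ℕ => if n = 0 then coeff f 0 else 0) (coeff f 0) :=
    hasSum_ite_eq 0 (coeff f 0)
  have hint := HasSum.of_nat_of_neg (f := g) (by simpa only [hpos] using hsc.add hd)
    (by simpa only [hneg] using hs.add hd)
  have hg0 : g 0 = coeff f 0 := by simp [hg]
  rw [hreindex, hint.tsum_eq, hg0]
  have hre := Complex.add_conj (powSum (resCoeff f ν) w)
  push_cast at hre ⊢
  rw [← hre]
  ring

theorem deriv_average_zmultiples (x : ℝ) :
    deriv (average f (AddSubgroup.zmultiples (ν : ℤ) : Set ℤ)) x =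
      ((2 * ν * (powSum (eulerCoeff (resCoeff f ν))
        (Complex.exp (Complex.I * ((-ν * x : ℝ) : ℂ)))).im : ℝ) : ℂ) := by
  have h0 : HasDerivAt (fun x : ℝ => -(ν : ℝ) * x) (-ν * 1) x :=
    (hasDerivAt_id x).const_mul (-(ν : ℝ))
  have h1 := (hasDerivAt_powSum_exp_mul_I (summable_eulerCoeff_resCoeff hν hf)
    (resCoeff_zero f ν) (-ν * x)).scomp x h0
  have h2 := (((Complex.reCLM.hasFDerivAt.comp_hasDerivAt x h1).const_mul 2).ofReal_comp).const_add
    (coeff f 0)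
  refine (h2.congr_of_eventuallyEq
    (f₁ := average f (AddSubgroup.zmultiples (ν : ℤ) : Set ℤ))
    (Eventually.of_forall fun y => average_zmultiples_eq hν hf y)).deriv.trans ?_
  congr 1
  simp
  ring

end average

/-! ### Trajectories in the original coordinates -/

section

variable {f : C(Circ, ℝ)} {ω₁ ω₂ ε p : ℝ} {μ ν : ℕ} (hμ : 0 < μ) (hν : 0 < ν)
  (hf : Summable fun k : ℕ => (k : ℝ) * ‖coeff f (k : ℤ)‖) (hω₁ : 0 < ω₁) (hε : 0 < ε) (hp : 0 < p)
  (hratio : ω₂ / ω₁ = (μ : ℝ) / (ν : ℝ))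
include hμ hν hf hω₁ hε hp hratio


theorem exists_isTrajectory {x : ℝ × ℝ} (hx : ∀ J, 0 < J →
      actionMap f ε p ((μ : ℝ) / ν) 0 x.1 J = x.2 →
      initialLevel (resCoeff f ν) f ε p μ ν (x.1, J) ∉ criticalLevels (resCoeff f ν))
    (hpos : 0 < x.2) (y : ℝ) :
    ∃ φ₁ φ₂ I₁ I₂ : ℝ → ℝ, IsTrajectory f ω₁ ω₂ ε p μ ν φ₁ φ₂ I₁ I₂ ∧
      φ₁ 0 = x.1 ∧ I₁ 0 = x.2 ∧ I₂ 0 = y := by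
  have hν' : (ν : ℝ) ≠ 0 := by exact_mod_cast hν.ne'
  have hμ' : (μ : ℝ) ≠ 0 := by exact_mod_cast hμ.ne'
  have hμ0 : (0 : ℝ) < μ := by exact_mod_cast hμ
  obtain ⟨J₀, hJ₀, hact⟩ := exists_actionMap_eq (μ := μ) hν hf hp ε 0 x.1 hpos
  have hlev := hx J₀ hJ₀ hact
  -- The level 0 is critical because P and D both vanish at the origin.
  have hne : initialLevel (resCoeff f ν) f ε p μ ν (x.1, J₀) ≠ 0 := by
    intro h0
    refine hlev ⟨0, ?_, Or.inl ⟨by simp, ?_⟩⟩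
    · rw [h0, powSum, tsum_eq_single 0 fun n hn => by simp [hn]]
      simp [resCoeff_zero]
    · rw [powSum, tsum_eq_single 0 fun n hn => by simp [hn]]
      simp [eulerCoeff]
  obtain ⟨θ, J, hslow, hθ0, hJ0⟩ := exists_isSlowSolution (κ := ε * μ * ω₁)
    (summable_eulerCoeff_resCoeff hν hf) (resCoeff_zero f ν) (by positivity) hp hμ
    (μ * angleMap f ε p ((μ : ℝ) / ν) 0 x.1 J₀) hJ₀ hne
  -- The initial J₂ is shifted by ε ∂S₁/∂φ₂ at time 0, so that I₂(0) = y.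
  have havg := hslow.isAvgSolution hμ hν hf hp
    (y - ε * deriv (fun s => genS₁ f p ((μ : ℝ) / ν) x.1 s J₀) 0)
  -- The angle φ₁(t) is chosen separately at each time, as a trajectory need only satisfy the
  -- relation pointwise; at t = 0 the prescribed value is taken.
  have hφ : ∀ t, ∃ φ, (t = 0 → φ = x.1) ∧ (0 ≤ t →
      (θ t + ν * (ω₁ / ν * μ * t)) / μ =
        angleMap f ε p ((μ : ℝ) / ν) (ω₁ / ν * μ * t) φ (J t)) := by
    intro t
    by_cases ht : t = 0
    · refine ⟨x.1, fun _ => rfl, fun _ => ?_⟩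
      subst ht
      rw [hθ0, hJ0]
      simp only [mul_zero, add_zero]
      exact mul_div_cancel_left₀ _ hμ'
    · by_cases ht0 : 0 ≤ t
      · obtain ⟨φ, hφ⟩ := exists_angleMap_eq (μ := μ) hν hf hp ε (ω₁ / ν * μ * t)
          ((θ t + ν * (ω₁ / ν * μ * t)) / μ) (hslow.pos t ht0)
        exact ⟨φ, fun h => absurd h ht, fun _ => hφ.symm⟩
      · exact ⟨0, fun h => absurd h ht, fun h => absurd h ht0⟩
  choose φ hφ0 hφ using hφ
  refine ⟨φ, fun t => ω₁ / ν * μ * t,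
    fun t => actionMap f ε p ((μ : ℝ) / ν) (ω₁ / ν * μ * t) (φ t) (J t),
    fun t => (y - ε * deriv (fun s => genS₁ f p ((μ : ℝ) / ν) x.1 s J₀) 0 -
        ν / μ * (J t - J 0)) +
      ε * deriv (fun s => genS₁ f p ((μ : ℝ) / ν) (φ t) s (J t)) (ω₁ / ν * μ * t),
    ⟨by simp, _, _, _, _, havg, fun t ht => ?_⟩, hφ0 0 rfl, ?_, ?_⟩
  · rw [hratio]
    exact (corresponds_iff hν hf hp (hslow.pos t ht) _ _ _ _ _ _ _ _).2
      ⟨hφ t ht, rfl, rfl, rfl⟩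
  · simp only [mul_zero, hφ0 0 rfl, hJ0, hact]
  · simp only [mul_zero, hφ0 0 rfl, hJ0, sub_self]
    ring

theorem tendsto_of_isTrajectory {x : ℝ × ℝ} (hx : ∀ J, 0 < J →
      actionMap f ε p ((μ : ℝ) / ν) 0 x.1 J = x.2 →
      initialLevel (resCoeff f ν) f ε p μ ν (x.1, J) ∉ criticalLevels (resCoeff f ν))
    {φ₁ φ₂ I₁ I₂ : ℝ → ℝ} (h : IsTrajectory f ω₁ ω₂ ε p μ ν φ₁ φ₂ I₁ I₂)
    (hφ0 : φ₁ 0 = x.1) (hI0 : I₁ 0 = x.2) :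
    ∃ φinf C : ℝ, Tendsto (fun t : ℝ => φ₁ t - ω₁ * t) atTop (𝓝 φinf) ∧
      Tendsto (fun t : ℝ => I₁ t / t) atTop (𝓝 C) ∧ 0 < C ∧
      (C : ℂ) = -((ε : ℂ) * (ω₂ : ℂ) / 2) *
        deriv (average f (AddSubgroup.zmultiples (ν : ℤ) : Set ℤ))
          (-(φinf + Real.pi / 2) * (ω₂ / ω₁)) := by
  have hν' : (ν : ℝ) ≠ 0 := by exact_mod_cast hν.ne'
  have hμ' : (μ : ℝ) ≠ 0 := by exact_mod_cast hμ.ne'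
  have hμ0 : (0 : ℝ) < μ := by exact_mod_cast hμ
  obtain ⟨hφ₂0, ψ₁, ψ₂, J₁, J₂, hsol, hcorr⟩ := h
  rw [hratio] at hcorr
  have hc := fun t ht => (corresponds_iff hν hf hp (hsol.pos t ht) _ _ _ _ _ _ _ _).1 (hcorr t ht)
  have hslow := hsol.isSlowSolution hμ hν hf hp
  have hψ₂0 : ψ₂ 0 = 0 := (hc 0 le_rfl).2.1.trans hφ₂0
  have hlev := hx (J₁ 0) (hsol.pos 0 le_rfl) (by
    rw [← hI0, (hc 0 le_rfl).2.2.1, hφ₂0, hφ0])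
  have hcrit : (powSum (resCoeff f ν) (diskPoint μ p (μ * ψ₁ 0 - ν * ψ₂ 0) (J₁ 0))).re ∉
      criticalLevels (resCoeff f ν) := by
    rw [hψ₂0, mul_zero, sub_zero, (hc 0 le_rfl).1, hφ₂0, hφ0]
    exact hlev
  obtain ⟨θinf, C, hJtop, hθ, hJC, hC0, hCeq⟩ := hslow.exists_tendsto
    (summable_eulerCoeff_resCoeff hν hf) (resCoeff_zero f ν) (by positivity) hp hμ hcrit
  refine ⟨θinf / μ, C, ?_, ?_, hC0, ?_⟩
  · obtain ⟨A, hA0, hA⟩ := exists_abs_angleMap_sub_le (μ := μ) hν hf hp ε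
    have h1 : Tendsto (fun t => φ₁ t - ψ₁ t) atTop (𝓝 0) := by
      refine squeeze_zero_norm' ?_ (tendsto_const_nhds (x := A).div_atTop hJtop)
      filter_upwards [eventually_ge_atTop 0] with t ht
      rw [norm_sub_rev, Real.norm_eq_abs, (hc t ht).1]
      exact hA _ _ _ (hsol.pos t ht)
    have h2 := h1.add (hθ.div_const (μ : ℝ))
    rw [zero_add] at h2
    refine h2.congr' ?_
    filter_upwards [eventually_ge_atTop 0] with t ht
    rw [hsol.psi_two_eq ht, hψ₂0]
    field_simp
    ring
  · have h1 : Tendsto (fun t => (I₁ t - J₁ t) / t) atTop (𝓝 0) := by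
      rw [Metric.tendsto_atTop]
      intro η hη
      -- As J₁/t → C, this slope makes the limiting error ηC/(2(C + 1)), which is below η.
      obtain ⟨A, hA⟩ := exists_abs_actionMap_sub_le (μ := μ) hν hf hp ε
        (η := η / (2 * (C + 1))) (by positivity)
      have hlim : Tendsto (fun t => A / t + η / (2 * (C + 1)) * (J₁ t / t)) atTop
          (𝓝 (0 + η / (2 * (C + 1)) * C)) :=
        (tendsto_const_nhds.div_atTop tendsto_id).add (hJC.const_mul _)
      have hlt : 0 + η / (2 * (C + 1)) * C < η := by
        rw [zero_add, div_mul_eq_mul_div, div_lt_iff₀ (by positivity)]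
        nlinarith
      obtain ⟨T, hT⟩ := eventually_atTop.1
        ((hlim.eventually (gt_mem_nhds hlt)).and (eventually_gt_atTop 0))
      refine ⟨T, fun t ht => ?_⟩
      obtain ⟨h2, h3⟩ := hT t ht
      rw [dist_zero_right, Real.norm_eq_abs, abs_div, abs_of_pos h3]
      refine lt_of_le_of_lt ?_ h2
      have h4 := hA (φ₂ t) (φ₁ t) (J₁ t) (hsol.pos t h3.le)
      rw [← (hc t h3.le).2.2.1] at h4
      rw [mul_div_assoc', ← add_div]
      gcongr
    have h2 := h1.add hJC
    rw [zero_add] at h2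
    refine h2.congr fun t => ?_
    rw [← add_div, sub_add_cancel]
  · have hexp : Complex.exp (Complex.I * ((-ν * (-(θinf / μ + Real.pi / 2) * (ω₂ / ω₁)) : ℝ) : ℂ)) =
        Complex.I ^ μ * Complex.exp (Complex.I * θinf) := by
      have e : -ν * (-(θinf / μ + Real.pi / 2) * (ω₂ / ω₁)) = μ * (Real.pi / 2) + θinf := by
        rw [hratio]; field_simp; ring
      rw [e]
      push_cast
      rw [mul_add, Complex.exp_add]
      congr 1
      rw [mul_left_comm, Complex.exp_nat_mul, mul_comm Complex.I, Complex.exp_pi_div_two_mul_I]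
    have hω₂ : ω₂ * ν = ω₁ * μ := by
      rw [div_eq_div_iff hω₁.ne' hν'] at hratio
      linarith
    rw [deriv_average_zmultiples hν hf, hexp, hCeq]
    push_cast
    have hω₂' : (ω₂ : ℂ) * ν = ω₁ * μ := by exact_mod_cast hω₂
    linear_combination (-(ε : ℂ) * ((powSum (eulerCoeff (resCoeff f ν))
      (Complex.I ^ μ * Complex.exp (Complex.I * θinf))).im : ℂ)) * (-hω₂')

end

end VonZeipel

end

theorem proposition2 (f : C(VonZeipel.Circ, ℝ)) (ω₁ ω₂ ε pθ : ℝ) (μ ν : ℕ)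
    (hω₁ : 0 < ω₁) (hω₂ : 0 < ω₂) (hε : 0 < ε) (hpθ : 0 < pθ)
    (hf : Summable fun k : ℕ => (k : ℝ) * ‖VonZeipel.coeff f (k : ℤ)‖)
    (hμ : 0 < μ) (hν : 0 < ν) (hμν : Nat.Coprime μ ν)
    (hratio : ω₂ / ω₁ = (μ : ℝ) / (ν : ℝ))
    (hres : (Function.support (VonZeipel.coeff f) ∩
      ((AddSubgroup.zmultiples (ν : ℤ) : Set ℤ) \ {0})).Nonempty) :
    ∀ᵐ x : ℝ × ℝ,
      (0 < x.2 → ∀ y : ℝ, ∃ φ₁ φ₂ I₁ I₂ : ℝ → ℝ,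
        VonZeipel.IsTrajectory f ω₁ ω₂ ε pθ μ ν φ₁ φ₂ I₁ I₂ ∧
          φ₁ 0 = x.1 ∧ I₁ 0 = x.2 ∧ I₂ 0 = y) ∧
      ∀ φ₁ φ₂ I₁ I₂ : ℝ → ℝ,
        VonZeipel.IsTrajectory f ω₁ ω₂ ε pθ μ ν φ₁ φ₂ I₁ I₂ →
        φ₁ 0 = x.1 → I₁ 0 = x.2 →
        ∃ φinf C : ℝ,
          Tendsto (fun t : ℝ => φ₁ t - ω₁ * t) atTop (𝓝 φinf) ∧
          Tendsto (fun t : ℝ => I₁ t / t) atTop (𝓝 C) ∧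
          0 < C ∧
          (C : ℂ) = -((ε : ℂ) * (ω₂ : ℂ) / 2) *
            deriv (VonZeipel.average f (AddSubgroup.zmultiples (ν : ℤ) : Set ℤ))
              (-(φinf + Real.pi / 2) * (ω₂ / ω₁)) := by
  have hb := VonZeipel.summable_eulerCoeff_resCoeff hν hf
  have b0 := VonZeipel.resCoeff_zero f ν
  have hne := VonZeipel.resCoeff_ne_zero hres
  filter_upwards [VonZeipel.ae_initialLevel_notMem hb b0 hμ hν hf hpθ hne ε
    (VonZeipel.volume_criticalLevels hb b0 hne)] with x hx
  exact ⟨fun hpos y => VonZeipel.exists_isTrajectory hμ hν hf hω₁ hε hpθ hratio hx hpos y,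
    fun φ₁ φ₂ I₁ I₂ h hφ0 hI0 =>
      VonZeipel.tendsto_of_isTrajectory hμ hν hf hω₁ hε hpθ hratio hx h hφ0 hI0⟩
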